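/- **Setting.** A tabular episodic two-player zero-sum Markov game consists of a number of steps $H\ge 1$, a finite state set $\mathcal S$ with $|\mathcal S|\le S$, finite nonempty action sets $\mathcal A,\mathcal B$ with $|\mathcal A|=A$, $|\mathcal B|=B$ of the max- and the min-player, transition laws $P_h(\cdot\mid s,a,b)$ on $\mathcal S$, deterministic rewards $r_h(s,a,b)\in[0,1]$ ($1\le h\le H$), and a fixed initial state $s_1$. A general policy of a player draws a random number $z\in\mathbb R$ from some law and then chooses a distribution over the player's actions at step $h$ as a function of $z$ and of $(s_1,a_1,b_1,r_1,\dots,s_h)$. $V_1^{\mu,\nu}(s_1)$ is the expected total reward of an episode, $V_1^{\dagger,\nu}(s_1)=\sup_\mu V_1^{\mu,\nu}(s_1)$ and $V_1^{\mu,\dagger}(s_1)=\inf_\nu V_1^{\mu,\nu}(s_1)$, over all general policies. **Algorithm (optimistic Nash Q-learning, $K\ge 1$ episodes).** Let $p\in(0,1]$, $T=KH$, $\iota=\log(SABT/p)$, $\alpha_t=\frac{H+1}{H+t}$ and $\beta_t=c\sqrt{H^3\iota/t}$. Let $\mathrm{CCE}$ be any subroutine that maps a pair of matrices $P,Q\in[0,H]^{\mathcal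 A\times\mathcal B}$ to a distribution $\pi$ on $\mathcal A\times\mathcal B$ with $\mathbb E_{(a,b)\sim\pi}P(a,b)\ge\max_{a'}\mathbb E_{(a,b)\sim\pi}P(a',b)$ and $\mathbb E_{(a,b)\sim\pi}Q(a,b)\le\min_{b'}\mathbb E_{(a,b)\sim\pi}Q(a,b')$. Initialize, for all $h,s,a,b$, $\widetilde Q^{+}_h(s,a,b)=H$, $\widetilde Q^{-}_h(s,a,b)=0$, $N_h(s,a,b)=0$, and $\pi_h(\cdot,\cdot\mid s)$ uniform. Throughout, let $Q^{\pm}_h=\max\{0,\min\{H,\widetilde Q^{\pm}_h\}\}$ be the upper and lower $Q$-estimates and $V^{\pm}_h(s)=\mathbb E_{(a,b)\sim\pi_h(\cdot,\cdot\mid s)}Q^{\pm}_h(s,a,b)$ for $h\le H$, $V^{\pm}_{H+1}=0$. In every episode, start at $s_1$; at steps $h=1,\dots,H$ draw $(a_h,b_h)\sim\pi_h(\cdot,\cdot\mid s_h)$, observe $r_h$ and $s_{h+1}\sim P_h(\cdot\mid s_h,a_h,b_h)$, increase $N_h(s_h,a_h,b_h)$ by one to $t$, set $$\widetilde Q^{\pm}_h(s_h,a_h,b_h)\leftarrow(1-\alpha_t)\widetilde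 Q^{\pm}_h(s_h,a_h,b_h)+\alpha_t\bigl(r_h(s_h,a_h,b_h)+V^{\pm}_{h+1}(s_{h+1})\pm\beta_t\bigr),$$ and then $\pi_h(\cdot,\cdot\mid s_h)\leftarrow\mathrm{CCE}\bigl(Q^{+}_h(s_h,\cdot,\cdot),Q^{-}_h(s_h,\cdot,\cdot)\bigr)$. **Certified policies.** Let $\pi^k$ be the joint policy at the beginning of episode $k$, with marginals $\mu^k,\nu^k$, and let $k^1<\dots<k^t<k$ be the episodes before $k$ in which $(s,a,b)$ occurred at step $h$. The policy $\hat\mu$ draws $k$ uniformly from $\{1,\dots,K\}$; at each step $h$ it plays $a_h\sim\mu^k_h(\cdot\mid s_h)$, observes $b_h$, forms $k^1,\dots,k^t$ for $(s_h,a_h,b_h)$, draws $m\in\{1,\dots,t\}$ with probability $\alpha_t^m=\alpha_m\prod_{j=m+1}^t(1-\alpha_j)$, and replaces $k$ by $k^m$; if $t=0$, it plays the rest of the episode by an arbitrary Markov policy fixed in advance. The policy $\hat\nu$ is defined in the same way with $\nu^k$. **Theorem.** There is an absolute constant $c_0>0$ such that for every $c\ge c_0$ there is a constant $C>0$, depending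 only on $c$, with the following property. For every such game, every CCE subroutine, every $p\in(0,1]$, every $\varepsilon>0$ and every $K\ge1$ with $$K\ \ge\ C\,\frac{H^5SAB\,\iota}{\varepsilon^2},$$ if optimistic Nash Q-learning is run for $K$ episodes, then with probability at least $1-p$ the certified policies $(\hat\mu,\hat\nu)$ form an $\varepsilon$-approximate Nash equilibrium, that is, $V_1^{\dagger,\hat\nu}(s_1)-V_1^{\hat\mu,\dagger}(s_1)\le\varepsilon$. -/

import Mathlib

open scoped BigOperators

noncomputable section

/-- A tabular episodic two-player zero-sum Markov game with `H` steps per episode and a fixed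
initial state. Steps are numbered `h = 1, …, H`; the data at other `h` are never used. -/
structure MarkovGame (𝒮 𝒜 ℬ : Type*) where
  /-- number of steps in an episode -/
  H : ℕ
  /-- `P h s a b` is the law of the next state -/
  P : ℕ → 𝒮 → 𝒜 → ℬ → PMF 𝒮
  /-- deterministic reward, with values in `[0, 1]` -/
  r : ℕ → 𝒮 → 𝒜 → ℬ → ℝ
  r_mem : ∀ h s a b, r h s a b ∈ Set.Icc (0 : ℝ) 1
  /-- initial state -/
  s₁ : 𝒮

/-- Expectation of a real function under a discrete law. -/
def pmfExpect {α : Type*} (p : PMF α) (f : α → ℝ) : ℝ := ∑' x, (p x).toReal * f x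

/-! ### Policies and values -/

/-- A history `(s₁, a₁, b₁, r₁), …, (s_{h-1}, a_{h-1}, b_{h-1}, r_{h-1})`; the step `h` is
recovered from its length. -/
abbrev History (𝒮 𝒜 ℬ : Type*) := List (𝒮 × 𝒜 × ℬ × ℝ)

/-- A general (history-dependent) policy of the player with action set `𝒳`: a random number `z` is
drawn from `seedLaw`, is shared by all steps, and together with the history and the current state
determines the distribution of the next action. -/
structure GeneralPolicy (𝒮 𝒜 ℬ 𝒳 : Type*) where
  seedLaw : MeasureTheory.Measure ℝ
  isProb : MeasureTheory.IsProbabilityMeasure seedLaw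
  act : ℝ → History 𝒮 𝒜 ℬ → 𝒮 → PMF 𝒳
  measurable_act : ∀ (τ : History 𝒮 𝒜 ℬ) (s : 𝒮) (x : 𝒳), Measurable fun z => act z τ s x

/-- A randomized procedure that plays the game with a private memory `M`. At step `h`, in memory
`m` and state `s`, it draws its action from `act h m s`; having seen the pair of actions `(a, b)`
it redraws its memory from `next h m s a b`. -/
structure Procedure (M 𝒮 𝒜 ℬ 𝒳 : Type*) where
  init : PMF M
  act : ℕ → M → 𝒮 → PMF 𝒳
  next : ℕ → M → 𝒮 → 𝒜 → ℬ → PMF M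

variable {𝒮 𝒜 ℬ : Type*}

/-- A general policy with the value `z` of its random number fixed is the procedure whose memory is
the history. -/
def GeneralPolicy.atSeed {𝒳 : Type*} (G : MarkovGame 𝒮 𝒜 ℬ) (μ : GeneralPolicy 𝒮 𝒜 ℬ 𝒳) (z : ℝ) :
    Procedure (History 𝒮 𝒜 ℬ) 𝒮 𝒜 ℬ 𝒳 where
  init := PMF.pure []
  act := fun _ τ s => μ.act z τ s
  next := fun h τ s a b => PMF.pure (τ ++ [(s, a, b, G.r h s a b)])

/-- Law of the state-action trajectory of `n` steps, from step `h` on, when the max-player follows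
`μ` and the min-player follows `ν`, from memories `m`, `l` and state `s`. -/
def playFrom {M L : Type*} (G : MarkovGame 𝒮 𝒜 ℬ) (μ : Procedure M 𝒮 𝒜 ℬ 𝒜)
    (ν : Procedure L 𝒮 𝒜 ℬ ℬ) : ℕ → ℕ → M → L → 𝒮 → PMF (List (𝒮 × 𝒜 × ℬ))
  | 0, _, _, _, _ => PMF.pure []
  | n + 1, h, m, l, s =>
    (μ.act h m s).bind fun a => (ν.act h l s).bind fun b =>
      (G.P h s a b).bind fun s' => (μ.next h m s a b).bind fun m' =>
        (ν.next h l s a b).bind fun l' =>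
          (playFrom G μ ν n (h + 1) m' l' s').map fun τ => (s, a, b) :: τ

/-- Sum of the rewards along a trajectory that starts at step `h`. -/
def totalReward (G : MarkovGame 𝒮 𝒜 ℬ) : ℕ → List (𝒮 × 𝒜 × ℬ) → ℝ
  | _, [] => 0
  | h, (s, a, b) :: τ => G.r h s a b + totalReward G (h + 1) τ

/-- The value `V₁^{μ,ν}(s₁)`: the expected cumulative reward of an episode. -/
def value {M L : Type*} (G : MarkovGame 𝒮 𝒜 ℬ) (μ : Procedure M 𝒮 𝒜 ℬ 𝒜)
    (ν : Procedure L 𝒮 𝒜 ℬ ℬ) : ℝ :=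
  pmfExpect (μ.init.bind fun m => ν.init.bind fun l => playFrom G μ ν G.H 1 m l G.s₁)
    (totalReward G 1)

/-- `V₁^{†,ν}(s₁) = sup_μ V₁^{μ,ν}(s₁)`, over all general policies of the max-player. -/
def valueBestMax {L : Type*} (G : MarkovGame 𝒮 𝒜 ℬ) (ν : Procedure L 𝒮 𝒜 ℬ ℬ) : ℝ :=
  ⨆ μ : GeneralPolicy 𝒮 𝒜 ℬ 𝒜, ∫ z, value G (μ.atSeed G z) ν ∂μ.seedLaw

/-- `V₁^{μ,†}(s₁) = inf_ν V₁^{μ,ν}(s₁)`, over all general policies of the min-player. -/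
def valueBestMin {M : Type*} (G : MarkovGame 𝒮 𝒜 ℬ) (μ : Procedure M 𝒮 𝒜 ℬ 𝒜) : ℝ :=
  ⨅ ν : GeneralPolicy 𝒮 𝒜 ℬ ℬ, ∫ z, value G μ (ν.atSeed G z) ∂ν.seedLaw

/-! ### Coarse correlated equilibria -/

/-- `π` is a coarse correlated equilibrium of the general-sum matrix game in which the max-player
maximizes `P` and the min-player minimizes `Q`. -/
def IsCCE (P Q : 𝒜 → ℬ → ℝ) (π : PMF (𝒜 × ℬ)) : Prop :=
  (∀ a', pmfExpect π (fun x => P a' x.2) ≤ pmfExpect π (fun x => P x.1 x.2)) ∧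
  (∀ b', pmfExpect π (fun x => Q x.1 x.2) ≤ pmfExpect π (fun x => Q x.1 b'))

/-- `cce` is a CCE subroutine for pairs of matrices with entries in `[0, H]`. -/
def IsCCESubroutine (H : ℕ) (cce : (𝒜 → ℬ → ℝ) → (𝒜 → ℬ → ℝ) → PMF (𝒜 × ℬ)) : Prop :=
  ∀ P Q : 𝒜 → ℬ → ℝ, (∀ a b, P a b ∈ Set.Icc (0 : ℝ) H) → (∀ a b, Q a b ∈ Set.Icc (0 : ℝ) H) →
    IsCCE P Q (cce P Q)

/-! ### Step sizes -/

/-- Learning rate `α_t = (H + 1) / (H + t)`. -/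
def learningRate (H t : ℕ) : ℝ := ((H : ℝ) + 1) / ((H : ℝ) + t)

/-- `α_t^i = α_i ∏_{j = i+1}^t (1 - α_j)`. -/
def rateWeight (H t i : ℕ) : ℝ :=
  learningRate H i * ∏ j ∈ Finset.Ioc i t, (1 - learningRate H j)

/-- Bonus `β_t = c √(H³ ι / t)`. -/
def bonus (H : ℕ) (c ι : ℝ) (t : ℕ) : ℝ := c * √((H : ℝ) ^ 3 * ι / t)

theorem learningRate_nonneg (H t : ℕ) : 0 ≤ learningRate H t := by
  unfold learningRate; positivity

theorem learningRate_le_one (H : ℕ) {t : ℕ} (ht : 1 ≤ t) : learningRate H t ≤ 1 := by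
  have h1 : (1 : ℝ) ≤ t := by exact_mod_cast ht
  have h2 : (0 : ℝ) ≤ H := Nat.cast_nonneg H
  unfold learningRate
  rw [div_le_one (by linarith)]
  linarith

theorem learningRate_one (H : ℕ) : learningRate H 1 = 1 := by
  have h2 : (0 : ℝ) ≤ H := Nat.cast_nonneg H
  unfold learningRate
  rw [Nat.cast_one]
  exact div_self (by linarith)

theorem rateWeight_nonneg (H t i : ℕ) : 0 ≤ rateWeight H t i := by
  unfold rateWeight
  refine mul_nonneg (learningRate_nonneg H i) (Finset.prod_nonneg fun j hj => ?_)
  have hj1 : 1 ≤ j := by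
    have := (Finset.mem_Ioc.mp hj).1
    omega
  linarith [learningRate_le_one H hj1]

theorem rateWeight_self (H t : ℕ) : rateWeight H t t = learningRate H t := by
  simp [rateWeight]

theorem rateWeight_succ (H : ℕ) {t i : ℕ} (hi : i ≤ t) :
    rateWeight H (t + 1) i = (1 - learningRate H (t + 1)) * rateWeight H t i := by
  unfold rateWeight
  rw [← Finset.insert_Ioc_right_eq_Ioc_add_one hi, Finset.prod_insert (by simp)]
  ring

theorem sum_rateWeight (H t : ℕ) (ht : 0 < t) :
    ∑ i ∈ Finset.range t, rateWeight H t (i + 1) = 1 := by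
  induction t with
  | zero => omega
  | succ t ih =>
    rw [Finset.sum_range_succ, rateWeight_self]
    rcases Nat.eq_zero_or_pos t with h0 | hpos
    · subst h0
      simp [learningRate_one]
    · have h1 : ∑ i ∈ Finset.range t, rateWeight H (t + 1) (i + 1)
          = ∑ i ∈ Finset.range t, (1 - learningRate H (t + 1)) * rateWeight H t (i + 1) := by
        refine Finset.sum_congr rfl fun i hi => rateWeight_succ H ?_
        have := Finset.mem_range.mp hi
        omega
      rw [h1, ← Finset.mul_sum, ih hpos]
      ring

/-- The law on `{1, …, t}`, written as `Fin t`, that gives `i` the probability `α_t^i`. -/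
def rateLaw (H t : ℕ) (ht : 0 < t) : PMF (Fin t) :=
  PMF.ofFintype (fun i => ENNReal.ofReal (rateWeight H t (i + 1))) (by
    rw [Fin.sum_univ_eq_sum_range (fun i => ENNReal.ofReal (rateWeight H t (i + 1))),
      ← ENNReal.ofReal_sum_of_nonneg (fun i _ => rateWeight_nonneg H t (i + 1)),
      sum_rateWeight H t ht, ENNReal.ofReal_one])

/-! ### Optimistic Nash Q-learning -/

/-- What the learner stores: the two running `Q`-estimates, the visit counts and the joint
execution policy. -/
structure LearnerState (𝒮 𝒜 ℬ : Type*) where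
  rawUp : ℕ → 𝒮 → 𝒜 → ℬ → ℝ
  rawLow : ℕ → 𝒮 → 𝒜 → ℬ → ℝ
  N : ℕ → 𝒮 → 𝒜 → ℬ → ℕ
  π : ℕ → 𝒮 → PMF (𝒜 × ℬ)

/-- Upper `Q`-estimate: the running estimate, truncated to `[0, H]`. -/
def LearnerState.Qup (H : ℕ) (σ : LearnerState 𝒮 𝒜 ℬ) (h : ℕ) (s : 𝒮) (a : 𝒜) (b : ℬ) : ℝ :=
  max 0 (min (H : ℝ) (σ.rawUp h s a b))

/-- Lower `Q`-estimate: the running estimate, truncated to `[0, H]`. -/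
def LearnerState.Qlow (H : ℕ) (σ : LearnerState 𝒮 𝒜 ℬ) (h : ℕ) (s : 𝒮) (a : 𝒜) (b : ℬ) : ℝ :=
  max 0 (min (H : ℝ) (σ.rawLow h s a b))

/-- Upper value estimate: the mean of the upper `Q`-estimate under the execution policy, and `0` at
step `H + 1`. -/
def LearnerState.Vup (H : ℕ) (σ : LearnerState 𝒮 𝒜 ℬ) (h : ℕ) (s : 𝒮) : ℝ :=
  if H < h then 0 else pmfExpect (σ.π h s) fun x => σ.Qup H h s x.1 x.2

/-- Lower value estimate. -/
def LearnerState.Vlow (H : ℕ) (σ : LearnerState 𝒮 𝒜 ℬ) (h : ℕ) (s : 𝒮) : ℝ :=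
  if H < h then 0 else pmfExpect (σ.π h s) fun x => σ.Qlow H h s x.1 x.2

/-- Initialization: `Q`-estimates `H` and `0`, no visits, uniform execution policy. -/
def LearnerState.initial (𝒮 : Type*) {𝒜 ℬ : Type*} [Fintype 𝒜] [Nonempty 𝒜] [Fintype ℬ]
    [Nonempty ℬ] (H : ℕ) : LearnerState 𝒮 𝒜 ℬ where
  rawUp := fun _ _ _ _ => H
  rawLow := fun _ _ _ _ => 0
  N := fun _ _ _ _ => 0
  π := fun _ _ => PMF.uniformOfFintype (𝒜 × ℬ)

/-- Overwrite one entry of a table. -/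
def setEntry {V : Type*} (f : ℕ → 𝒮 → 𝒜 → ℬ → V) (h : ℕ) (s : 𝒮) (a : 𝒜) (b : ℬ) (v : V) :
    ℕ → 𝒮 → 𝒜 → ℬ → V := by
  classical
  exact fun h' s' a' b' => if h' = h ∧ s' = s ∧ a' = a ∧ b' = b then v else f h' s' a' b'

/-- The update of both `Q`-estimates and of the visit count after `(s, a, b)` was played at step `h`
and led to the state `s'`. -/
def LearnerState.updateQ (G : MarkovGame 𝒮 𝒜 ℬ) (β : ℕ → ℝ) (σ : LearnerState 𝒮 𝒜 ℬ)
    (h : ℕ) (s : 𝒮) (a : 𝒜) (b : ℬ) (s' : 𝒮) : LearnerState 𝒮 𝒜 ℬ :=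
  let t := σ.N h s a b + 1
  let α := learningRate G.H t
  { rawUp := setEntry σ.rawUp h s a b
      ((1 - α) * σ.rawUp h s a b + α * (G.r h s a b + σ.Vup G.H (h + 1) s' + β t))
    rawLow := setEntry σ.rawLow h s a b
      ((1 - α) * σ.rawLow h s a b + α * (G.r h s a b + σ.Vlow G.H (h + 1) s' - β t))
    N := setEntry σ.N h s a b t
    π := σ.π }

/-- The update of the execution policy at `(h, s)`: a CCE of the current pair of `Q`-estimates. -/
def LearnerState.updatePolicy (H : ℕ) (cce : (𝒜 → ℬ → ℝ) → (𝒜 → ℬ → ℝ) → PMF (𝒜 × ℬ))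
    (σ : LearnerState 𝒮 𝒜 ℬ) (h : ℕ) (s : 𝒮) : LearnerState 𝒮 𝒜 ℬ := by
  classical
  exact { σ with
    π := fun h' s' => if h' = h ∧ s' = s then cce (σ.Qup H h s) (σ.Qlow H h s) else σ.π h' s' }

/-- A recorded episode: entry number `h - 1` is `(s_h, a_h, b_h, s_{h+1})`. -/
abbrev Episode (𝒮 𝒜 ℬ : Type*) := List (𝒮 × 𝒜 × ℬ × 𝒮)

/-- All updates of an episode (recorded from step `h` on), in the order of the steps. -/
def LearnerState.processEpisode (G : MarkovGame 𝒮 𝒜 ℬ) (β : ℕ → ℝ)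
    (cce : (𝒜 → ℬ → ℝ) → (𝒜 → ℬ → ℝ) → PMF (𝒜 × ℬ)) :
    ℕ → Episode 𝒮 𝒜 ℬ → LearnerState 𝒮 𝒜 ℬ → LearnerState 𝒮 𝒜 ℬ
  | _, [], σ => σ
  | h, (s, a, b, s') :: τ, σ =>
    LearnerState.processEpisode G β cce (h + 1) τ
      ((σ.updateQ G β h s a b s').updatePolicy G.H cce h s)

/-- The state of the learner after the episodes `es`. -/
def learnerAfter [Fintype 𝒜] [Nonempty 𝒜] [Fintype ℬ] [Nonempty ℬ] (G : MarkovGame 𝒮 𝒜 ℬ)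
    (β : ℕ → ℝ) (cce : (𝒜 → ℬ → ℝ) → (𝒜 → ℬ → ℝ) → PMF (𝒜 × ℬ))
    (es : List (Episode 𝒮 𝒜 ℬ)) : LearnerState 𝒮 𝒜 ℬ :=
  es.foldl (fun σ e => LearnerState.processEpisode G β cce 1 e σ)
    (LearnerState.initial 𝒮 G.H)

/-- Law of `n` steps of play, from step `h` and state `s` on, when the pair of actions at step `h'`
is drawn from `π h'`. The update after step `h` changes `π` at step `h` only, so that the actions
of a whole episode are drawn from the policy held when the episode begins. -/
def episodeLaw (G : MarkovGame 𝒮 𝒜 ℬ) (π : ℕ → 𝒮 → PMF (𝒜 × ℬ)) :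
    ℕ → ℕ → 𝒮 → PMF (Episode 𝒮 𝒜 ℬ)
  | 0, _, _ => PMF.pure []
  | n + 1, h, s =>
    (π h s).bind fun x => (G.P h s x.1 x.2).bind fun s' =>
      (episodeLaw G π n (h + 1) s').map fun τ => (s, x.1, x.2, s') :: τ

/-- Law of the record of the first `K` episodes of optimistic Nash Q-learning. -/
def nashQLaw [Fintype 𝒜] [Nonempty 𝒜] [Fintype ℬ] [Nonempty ℬ] (G : MarkovGame 𝒮 𝒜 ℬ)
    (β : ℕ → ℝ) (cce : (𝒜 → ℬ → ℝ) → (𝒜 → ℬ → ℝ) → PMF (𝒜 × ℬ)) :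
    ℕ → PMF (List (Episode 𝒮 𝒜 ℬ))
  | 0 => PMF.pure []
  | K + 1 =>
    (nashQLaw G β cce K).bind fun es =>
      (episodeLaw G (learnerAfter G β cce es).π G.H 1 G.s₁).map fun e => es ++ [e]

/-! ### Certified policies -/

/-- The joint execution policy at the beginning of episode number `k = 0, 1, …`. -/
def policyAt [Fintype 𝒜] [Nonempty 𝒜] [Fintype ℬ] [Nonempty ℬ] (G : MarkovGame 𝒮 𝒜 ℬ)
    (β : ℕ → ℝ) (cce : (𝒜 → ℬ → ℝ) → (𝒜 → ℬ → ℝ) → PMF (𝒜 × ℬ))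
    (es : List (Episode 𝒮 𝒜 ℬ)) (k : ℕ) : ℕ → 𝒮 → PMF (𝒜 × ℬ) :=
  (learnerAfter G β cce (es.take k)).π

/-- The episodes before episode `k` in which `(s, a, b)` occurred at step `h`, in increasing order:
`k¹ < k² < ⋯ < k^t < k`, where `t = N_h^k(s, a, b)`. -/
def visits (es : List (Episode 𝒮 𝒜 ℬ)) (k h : ℕ) (s : 𝒮) (a : 𝒜) (b : ℬ) : List ℕ := by
  classical
  exact (List.range k).filter fun j => ∃ s', (es.getD j [])[h - 1]? = some (s, a, b, s')

/-- Law of the next episode index `k^m`, where `m ∈ {1, …, t}` has probability `α_t^m`;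
`none` if `t = 0`. -/
def nextIndex (H : ℕ) (es : List (Episode 𝒮 𝒜 ℬ)) (k h : ℕ) (s : 𝒮) (a : 𝒜) (b : ℬ) :
    PMF (Option ℕ) :=
  if ht : 0 < (visits es k h s a b).length then
    (rateLaw H _ ht).map fun m => some ((visits es k h s a b).get m)
  else PMF.pure none

/-- Update of the episode index held by a certified policy. -/
def nextMemory (H : ℕ) (es : List (Episode 𝒮 𝒜 ℬ)) (h : ℕ) (m : Option ℕ) (s : 𝒮) (a : 𝒜) (b : ℬ) :
    PMF (Option ℕ) :=
  match m with
  | none => PMF.pure none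
  | some k => nextIndex H es k h s a b

/-- A uniformly random episode index. -/
def uniformIndex (K : ℕ) (hK : 0 < K) : PMF (Option ℕ) :=
  haveI : Nonempty (Fin K) := ⟨⟨0, hK⟩⟩
  (PMF.uniformOfFintype (Fin K)).map fun k => some (k : ℕ)

/-- The certified policy of the max-player. It starts with a uniformly random episode index `k`; at
step `h` it plays the max-player's marginal of the joint policy of episode `k`, and after observing
`(s, a, b)` it moves to one of the earlier episodes that visited `(s, a, b)` at step `h`. Once there
is no such episode it follows the fixed Markov policy `μ₀`. -/
def certifiedMax [Fintype 𝒜] [Nonempty 𝒜] [Fintype ℬ] [Nonempty ℬ] (G : MarkovGame 𝒮 𝒜 ℬ)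
    (β : ℕ → ℝ) (cce : (𝒜 → ℬ → ℝ) → (𝒜 → ℬ → ℝ) → PMF (𝒜 × ℬ)) (K : ℕ) (hK : 0 < K)
    (μ₀ : ℕ → 𝒮 → PMF 𝒜) (es : List (Episode 𝒮 𝒜 ℬ)) : Procedure (Option ℕ) 𝒮 𝒜 ℬ 𝒜 where
  init := uniformIndex K hK
  act := fun h m s => m.elim (μ₀ h s) fun k => (policyAt G β cce es k h s).map Prod.fst
  next := nextMemory G.H es

/-- The certified policy of the min-player. -/
def certifiedMin [Fintype 𝒜] [Nonempty 𝒜] [Fintype ℬ] [Nonempty ℬ] (G : MarkovGame 𝒮 𝒜 ℬ)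
    (β : ℕ → ℝ) (cce : (𝒜 → ℬ → ℝ) → (𝒜 → ℬ → ℝ) → PMF (𝒜 × ℬ)) (K : ℕ) (hK : 0 < K)
    (ν₀ : ℕ → 𝒮 → PMF ℬ) (es : List (Episode 𝒮 𝒜 ℬ)) : Procedure (Option ℕ) 𝒮 𝒜 ℬ ℬ where
  init := uniformIndex K hK
  act := fun h m s => m.elim (ν₀ h s) fun k => (policyAt G β cce es k h s).map Prod.snd
  next := nextMemory G.H es

/-- The pair `(μ, ν)` is an `ε`-approximate Nash equilibrium. -/
def IsApproxNash {M L : Type*} (G : MarkovGame 𝒮 𝒜 ℬ) (ε : ℝ) (μ : Procedure M 𝒮 𝒜 ℬ 𝒜)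
    (ν : Procedure L 𝒮 𝒜 ℬ ℬ) : Prop :=
  valueBestMax G ν - valueBestMin G μ ≤ ε

end

/-! The Nash value never enters. For every episode `k`, the lower estimate `Vlow` held at its
beginning is at most what the certified max-policy with memory `k` earns against any opponent, and
`Vup` is at least what any opponent earns against the certified min-policy with memory `k`.
Averaging over the uniform initial index bounds the duality gap by the mean over `k` of `Vup - Vlow`
at the initial state (`ValuesConcentrate.isApproxNash`). It remains to prove this optimism and to
bound the total width.

Optimism. Unrolling the updates (`raw_learnerAt_eq`) writes a raw estimate as an average, with
weights `rateWeight`, of reward plus next-step estimate at the sampled state plus or minus bonus,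
taken over the earlier visits. A certified policy redraws its memory with exactly these weights, so
its continuation is bounded by the same average, with each sampled state replaced by its law. The
difference is a martingale sum of order `√(H³ι/t)`, which the bonus absorbs
(`ValuesConcentrate.raw_le`). Each CCE inequality passes from the joint policy to one player's
marginal against a fixed action of the other, and backward induction over the steps gives
`ValuesConcentrate.low_le_expectedReward` and `ValuesConcentrate.expectedReward_le_up`.

Width. Along each state-action triple the quantity `(H + N) / H * (rawUp - rawLow)` telescopes, so
the total width at step `h` is at most an error plus `1 + 1/H` times the total width at step `h + 1`
(`IsRecord.totalWidth_le`). Over `H` steps the factors multiply to at most `e`. The error consists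
of the initial widths, the bonuses (summed by Cauchy-Schwarz) and the noise of the sampled actions.

Both kinds of deviation are controlled by exponential supermartingales along the run
(`expectENN_nashQLaw_exp_le`), Markov's inequality and one union bound over `badEvent`. -/

open scoped BigOperators

noncomputable section

variable {𝒮 𝒜 ℬ : Type*}

/-! ### Expectations with values in `[0, ∞]` -/

/-- Expectation of an extended nonnegative function under a discrete law. -/
def expectENN {α : Type*} (p : PMF α) (f : α → ENNReal) : ENNReal := ∑' x, p x * f x

theorem expectENN_pure {α : Type*} (a : α) (f : α → ENNReal) : expectENN (PMF.pure a) f = f a := by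
  unfold expectENN
  rw [tsum_eq_single a]
  · simp
  · intro b hb; simp [PMF.pure_apply, hb]

theorem expectENN_bind {α γ : Type*} (p : PMF α) (g : α → PMF γ) (f : γ → ENNReal) :
    expectENN (p.bind g) f = expectENN p fun x => expectENN (g x) f := by
  unfold expectENN
  simp only [PMF.bind_apply, ← ENNReal.tsum_mul_right, ← ENNReal.tsum_mul_left]
  rw [ENNReal.tsum_comm]
  simp only [mul_assoc]

theorem expectENN_map {α γ : Type*} (p : PMF α) (g : α → γ) (f : γ → ENNReal) :
    expectENN (p.map g) f = expectENN p fun x => f (g x) := by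
  simp only [PMF.map, expectENN_bind, Function.comp_apply, expectENN_pure]

theorem expectENN_const {α : Type*} (p : PMF α) (c : ENNReal) : expectENN p (fun _ => c) = c := by
  unfold expectENN
  rw [ENNReal.tsum_mul_right, p.tsum_coe, one_mul]

theorem expectENN_mono {α : Type*} (p : PMF α) {f g : α → ENNReal} (h : ∀ x, f x ≤ g x) :
    expectENN p f ≤ expectENN p g :=
  ENNReal.tsum_le_tsum fun x => mul_le_mul_right (h x) _

theorem expectENN_const_add {α : Type*} (p : PMF α) (c : ENNReal) (f : α → ENNReal) :
    expectENN p (fun x => c + f x) = c + expectENN p f := by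
  have h := expectENN_const p c
  unfold expectENN at *
  simp only [mul_add]
  rw [ENNReal.tsum_add, h]

theorem expectENN_const_mul {α : Type*} (p : PMF α) (c : ENNReal) (f : α → ENNReal) :
    expectENN p (fun x => c * f x) = c * expectENN p f := by
  unfold expectENN
  rw [← ENNReal.tsum_mul_left]
  simp only [mul_left_comm]

theorem expectENN_comm {α γ : Type*} (p : PMF α) (q : PMF γ) (f : α → γ → ENNReal) :
    expectENN p (fun x => expectENN q (f x)) = expectENN q fun y => expectENN p fun x => f x y := by
  unfold expectENN
  simp only [← ENNReal.tsum_mul_left]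
  rw [ENNReal.tsum_comm]
  simp only [mul_left_comm]

/-- The bridge from real expectations to `[0, ∞]`, where sums may be exchanged without summability
hypotheses. This matters because memories and trajectories range over arbitrary types. -/
theorem pmfExpect_eq_toReal {α : Type*} (p : PMF α) {f : α → ℝ} (hf : ∀ x, 0 ≤ f x) :
    pmfExpect p f = (expectENN p fun x => ENNReal.ofReal (f x)).toReal := by
  unfold pmfExpect expectENN
  rw [ENNReal.tsum_toReal_eq
    (fun x => ENNReal.mul_ne_top (p.apply_ne_top x) ENNReal.ofReal_ne_top)]
  simp [ENNReal.toReal_mul, ENNReal.toReal_ofReal (hf _)]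

theorem pmfExpect_eq_sum {α : Type*} [Fintype α] (p : PMF α) (f : α → ℝ) :
    pmfExpect p f = ∑ x, (p x).toReal * f x := tsum_fintype _

theorem sum_toReal_pmf {α : Type*} [Fintype α] (p : PMF α) : ∑ x, (p x).toReal = 1 := by
  have h := p.tsum_coe
  rw [tsum_fintype] at h
  rw [← ENNReal.toReal_sum fun x _ => p.apply_ne_top x, h, ENNReal.toReal_one]

theorem pmfExpect_const {α : Type*} [Fintype α] (p : PMF α) (c : ℝ) :
    pmfExpect p (fun _ => c) = c := by
  rw [pmfExpect_eq_sum, ← Finset.sum_mul, sum_toReal_pmf, one_mul]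

theorem pmfExpect_mono {α : Type*} [Fintype α] (p : PMF α) {f g : α → ℝ} (h : ∀ x, f x ≤ g x) :
    pmfExpect p f ≤ pmfExpect p g := by
  rw [pmfExpect_eq_sum, pmfExpect_eq_sum]
  exact Finset.sum_le_sum fun x _ => mul_le_mul_of_nonneg_left (h x) ENNReal.toReal_nonneg

theorem pmfExpect_sub {α : Type*} [Fintype α] (p : PMF α) (f g : α → ℝ) :
    pmfExpect p (fun x => f x - g x) = pmfExpect p f - pmfExpect p g := by
  simp only [pmfExpect_eq_sum, mul_sub, Finset.sum_sub_distrib]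

theorem pmfExpect_mem_Icc {α : Type*} [Fintype α] (p : PMF α) {f : α → ℝ} {M : ℝ}
    (h : ∀ x, f x ∈ Set.Icc 0 M) : pmfExpect p f ∈ Set.Icc 0 M := by
  constructor
  · rw [← pmfExpect_const p 0]; exact pmfExpect_mono p fun x => (h x).1
  · rw [← pmfExpect_const p M]; exact pmfExpect_mono p fun x => (h x).2

theorem expectENN_ofReal {α : Type*} [Fintype α] (p : PMF α) {f : α → ℝ} (hf : ∀ x, 0 ≤ f x) :
    expectENN p (fun x => ENNReal.ofReal (f x)) = ENNReal.ofReal (pmfExpect p f) := by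
  rw [pmfExpect_eq_sum, expectENN, tsum_fintype,
    ENNReal.ofReal_sum_of_nonneg fun x _ => mul_nonneg ENNReal.toReal_nonneg (hf x)]
  refine Finset.sum_congr rfl fun x _ => ?_
  rw [ENNReal.ofReal_mul ENNReal.toReal_nonneg, ENNReal.ofReal_toReal (p.apply_ne_top x)]

/-- Markov's inequality for an exponential moment. -/
theorem toOuterMeasure_le_exp_neg {α : Type*} (p : PMF α) (f : α → ℝ) (L : ℝ)
    (h : expectENN p (fun x => ENNReal.ofReal (Real.exp (f x))) ≤ 1) :
    p.toOuterMeasure {x | L < f x} ≤ ENNReal.ofReal (Real.exp (-L)) := by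
  have h1 : p.toOuterMeasure {x | L < f x}
      ≤ expectENN p fun x => ENNReal.ofReal (Real.exp (-L)) * ENNReal.ofReal (Real.exp (f x)) := by
    rw [PMF.toOuterMeasure_apply]
    refine ENNReal.tsum_le_tsum fun x => ?_
    by_cases hx : L < f x
    · rw [Set.indicator_of_mem (by exact hx)]
      conv_lhs => rw [← mul_one (p x)]
      refine mul_le_mul_right ?_ _
      beta_reduce
      rw [← ENNReal.ofReal_mul (Real.exp_pos _).le, ← Real.exp_add]
      rw [← ENNReal.ofReal_one]
      refine ENNReal.ofReal_le_ofReal ?_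
      rw [← Real.exp_zero]
      exact Real.exp_le_exp.2 (by linarith)
    · rw [Set.indicator_of_notMem (by exact hx)]
      exact zero_le
  refine h1.trans ?_
  rw [expectENN_const_mul]
  exact (mul_le_mul_right h _).trans (by rw [mul_one])

/-- A union bound: outside the support and finitely many unlikely sets, `good` holds. -/
theorem ofReal_one_sub_le_toOuterMeasure {α ι : Type*} (p : PMF α) (good : Set α) (I : Finset ι)
    (bad : ι → Set α) {q δ : ℝ} (hq : 0 ≤ q)
    (hsub : ∀ x ∈ p.support, (∀ i ∈ I, x ∉ bad i) → x ∈ good)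
    (hbad : ∀ i ∈ I, p.toOuterMeasure (bad i) ≤ ENNReal.ofReal δ) (hδ : (I.card : ℝ) * δ ≤ q) :
    ENNReal.ofReal (1 - q) ≤ p.toOuterMeasure good := by
  have h1 : 1 ≤ p.toOuterMeasure good + ∑ i ∈ I, p.toOuterMeasure (bad i) := by
    have hs : p.support ⊆ good ∪ ⋃ i ∈ I, bad i := by
      intro x hx
      by_cases hb : ∀ i ∈ I, x ∉ bad i
      · exact Or.inl (hsub x hx hb)
      · push Not at hb
        obtain ⟨i, hi, hxi⟩ := hb
        exact Or.inr (Set.mem_biUnion hi hxi)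
    calc (1 : ENNReal) = p.toOuterMeasure (good ∪ ⋃ i ∈ I, bad i) :=
          (((p.toOuterMeasure_apply_eq_one_iff _).2 hs)).symm
      _ ≤ _ := (MeasureTheory.measure_union_le _ _).trans
          (add_le_add le_rfl (MeasureTheory.measure_biUnion_finset_le _ _))
  have h2 : ∑ i ∈ I, p.toOuterMeasure (bad i) ≤ ENNReal.ofReal q := by
    calc ∑ i ∈ I, p.toOuterMeasure (bad i) ≤ ∑ _i ∈ I, ENNReal.ofReal δ := Finset.sum_le_sum hbad
      _ = ENNReal.ofReal (I.card * δ) := by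
          rw [Finset.sum_const, nsmul_eq_mul, ENNReal.ofReal_mul (Nat.cast_nonneg _),
            ENNReal.ofReal_natCast]
      _ ≤ _ := ENNReal.ofReal_le_ofReal hδ
  rw [ENNReal.ofReal_sub _ hq, ENNReal.ofReal_one, tsub_le_iff_right]
  exact h1.trans (add_le_add le_rfl h2)

/-! ### Hoeffding's lemma for discrete laws -/

/-- By convexity `exp` lies below its chord over `[-u, u]`, which is the right-hand side. For `u =
0` the quotient is `0` by convention, and `z = 0`. -/
theorem exp_le_cosh_add {z u : ℝ} (h : |z| ≤ u) :
    Real.exp z ≤ Real.cosh u + z * (Real.sinh u / u) := by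
  obtain ⟨h1, h2⟩ := abs_le.1 h
  have hu : 0 ≤ u := (abs_nonneg z).trans h
  rcases hu.eq_or_lt with rfl | hu
  · have : z = 0 := by linarith
    simp [this]
  · have hc : Real.exp ((u + z) / (2 * u) * u + (u - z) / (2 * u) * -u)
        ≤ (u + z) / (2 * u) * Real.exp u + (u - z) / (2 * u) * Real.exp (-u) :=
      convexOn_exp.2 (Set.mem_univ u) (Set.mem_univ (-u))
        (div_nonneg (by linarith) (by linarith)) (div_nonneg (by linarith) (by linarith))
        (by field_simp; ring)
    have e : (u + z) / (2 * u) * u + (u - z) / (2 * u) * -u = z := by field_simp; ring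
    rw [e] at hc
    refine hc.trans (le_of_eq ?_)
    rw [Real.cosh_eq, Real.sinh_eq]
    field_simp
    ring

/-- Averaging the chord bound kills its linear term, and `cosh u ≤ exp (u²/2)`. Using only that the
deviation from the mean is at most `M` gives the constant `1/2` instead of Hoeffding's `1/8`, which
suffices here. -/
theorem expectENN_exp_centered_le {α : Type*} [Fintype α] (p : PMF α) {f : α → ℝ} {M : ℝ}
    (hf : ∀ x, f x ∈ Set.Icc 0 M) (θ : ℝ) :
    expectENN p (fun x => ENNReal.ofReal
      (Real.exp (θ * (f x - pmfExpect p f) - θ ^ 2 * M ^ 2 / 2))) ≤ 1 := by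
  rw [expectENN_ofReal p fun x => (Real.exp_pos _).le]
  rw [← ENNReal.ofReal_one]
  refine ENNReal.ofReal_le_ofReal ?_
  have hm := pmfExpect_mem_Icc p hf
  set m := pmfExpect p f with hmdef
  set u := |θ| * M with hu
  have hbd : ∀ x, |θ * (f x - m)| ≤ u := by
    intro x
    rw [abs_mul]
    refine mul_le_mul_of_nonneg_left ?_ (abs_nonneg _)
    rw [abs_le]
    constructor <;> linarith [(hf x).1, (hf x).2, hm.1, hm.2]
  have hu2 : θ ^ 2 * M ^ 2 = u ^ 2 := by rw [hu, mul_pow, sq_abs]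
  calc pmfExpect p (fun x => Real.exp (θ * (f x - m) - θ ^ 2 * M ^ 2 / 2))
      ≤ pmfExpect p (fun x => Real.exp (-(u ^ 2 / 2)) *
          (Real.cosh u + θ * (f x - m) * (Real.sinh u / u))) := by
        refine pmfExpect_mono p fun x => ?_
        rw [hu2, sub_eq_add_neg, Real.exp_add, mul_comm]
        exact mul_le_mul_of_nonneg_left (exp_le_cosh_add (hbd x)) (Real.exp_pos _).le
    _ = Real.exp (-(u ^ 2 / 2)) * Real.cosh u := by
        have h0 : ∑ x, (p x).toReal * (f x - m) = 0 := by
          simp only [mul_sub, Finset.sum_sub_distrib]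
          rw [← Finset.sum_mul, sum_toReal_pmf, hmdef, pmfExpect_eq_sum]
          ring
        rw [pmfExpect_eq_sum]
        calc ∑ x, (p x).toReal * (Real.exp (-(u ^ 2 / 2)) *
              (Real.cosh u + θ * (f x - m) * (Real.sinh u / u)))
            = Real.exp (-(u ^ 2 / 2)) * Real.cosh u * ∑ x, (p x).toReal
              + Real.exp (-(u ^ 2 / 2)) * θ * (Real.sinh u / u) *
                ∑ x, (p x).toReal * (f x - m) := by
              rw [Finset.mul_sum, Finset.mul_sum, ← Finset.sum_add_distrib]
              exact Finset.sum_congr rfl fun x _ => by ring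
          _ = _ := by rw [h0, sum_toReal_pmf]; ring
    _ ≤ Real.exp (-(u ^ 2 / 2)) * Real.exp (u ^ 2 / 2) :=
        mul_le_mul_of_nonneg_left (Real.cosh_le_exp_half_sq u) (Real.exp_pos _).le
    _ = 1 := by rw [← Real.exp_add]; simp

/-! ### Sums along recorded episodes -/

/-- Sum of `f h` over the entries of an episode recorded from step `h` on. -/
def episodeSum (f : ℕ → 𝒮 × 𝒜 × ℬ × 𝒮 → ℝ) : ℕ → Episode 𝒮 𝒜 ℬ → ℝ
  | _, [] => 0
  | h, x :: τ => f h x + episodeSum f (h + 1) τ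

/-- Positions past the end of the list read `none` and contribute `0`, so any upper bound `n` on the
length may serve as range. -/
theorem episodeSum_eq_sum (f : ℕ → 𝒮 × 𝒜 × ℬ × 𝒮 → ℝ) (e : Episode 𝒮 𝒜 ℬ) :
    ∀ (h n : ℕ), e.length ≤ n →
      episodeSum f h e = ∑ i ∈ Finset.range n, (e[i]?).elim 0 (f (h + i)) := by
  induction e with
  | nil => intro h n _; simp [episodeSum]
  | cons x τ ih =>
    intro h n hn
    obtain ⟨n, rfl⟩ : ∃ m, n = m + 1 := ⟨n - 1, by simp at hn; omega⟩
    rw [Finset.sum_range_succ', episodeSum, ih (h + 1) n (by simpa using hn)]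
    simp [add_comm, add_left_comm]

/-- The exponential of the sum factors into the first transition and the rest. Given the first
transition the rest has mean at most `1` by induction, and then so does the first factor. -/
theorem expectENN_episodeLaw_exp_le (G : MarkovGame 𝒮 𝒜 ℬ) (π : ℕ → 𝒮 → PMF (𝒜 × ℬ))
    (f : ℕ → 𝒮 × 𝒜 × ℬ × 𝒮 → ℝ)
    (hf : ∀ h, 1 ≤ h → ∀ s, expectENN (π h s) (fun x => expectENN (G.P h s x.1 x.2) fun s' =>
      ENNReal.ofReal (Real.exp (f h (s, x.1, x.2, s')))) ≤ 1) (n : ℕ) :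
    ∀ h, 1 ≤ h → ∀ s, expectENN (episodeLaw G π n h s)
      (fun e => ENNReal.ofReal (Real.exp (episodeSum f h e))) ≤ 1 := by
  induction n with
  | zero => intro h _ s; simp [episodeLaw, expectENN_pure, episodeSum]
  | succ n ih =>
    intro h hh s
    simp only [episodeLaw, expectENN_bind, expectENN_map, episodeSum]
    refine le_trans (expectENN_mono _ fun x => expectENN_mono _ fun s' => ?_) (hf h hh s)
    simp only [Real.exp_add, ENNReal.ofReal_mul (Real.exp_pos _).le]
    rw [expectENN_const_mul]
    exact (mul_le_mul_right (ih (h + 1) (Nat.le_add_left 1 h) s') _).trans (by rw [mul_one])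

/-- Sum over all entries of a run, where the summand may depend on the preceding episodes. -/
def runSum (F : List (Episode 𝒮 𝒜 ℬ) → ℕ → 𝒮 × 𝒜 × ℬ × 𝒮 → ℝ) (es : List (Episode 𝒮 𝒜 ℬ)) : ℝ :=
  ∑ j ∈ Finset.range es.length, episodeSum (F (es.take j)) 1 (es.getD j [])

theorem runSum_append_singleton (F : List (Episode 𝒮 𝒜 ℬ) → ℕ → 𝒮 × 𝒜 × ℬ × 𝒮 → ℝ)
    (es : List (Episode 𝒮 𝒜 ℬ)) (e : Episode 𝒮 𝒜 ℬ) :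
    runSum F (es ++ [e]) = runSum F es + episodeSum (F es) 1 e := by
  unfold runSum
  rw [List.length_append, List.length_singleton, Finset.sum_range_succ]
  congr 1
  · refine Finset.sum_congr rfl fun j hj => ?_
    have hj' := Finset.mem_range.1 hj
    rw [List.take_append_of_le_length hj'.le, List.getD_append _ _ _ _ hj']
  · rw [List.take_left, List.getD_append_right _ _ _ _ le_rfl]
    simp

theorem runSum_eq_sum (F : List (Episode 𝒮 𝒜 ℬ) → ℕ → 𝒮 × 𝒜 × ℬ × 𝒮 → ℝ)
    (es : List (Episode 𝒮 𝒜 ℬ)) {n : ℕ} (hn : es.length ≤ n) :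
    runSum F es = ∑ j ∈ Finset.range n, episodeSum (F (es.take j)) 1 (es.getD j []) := by
  refine Finset.sum_subset (Finset.range_mono hn) fun j _ hj => ?_
  rw [List.getD_eq_default _ _ (by simpa using hj)]
  rfl

/-- An exponential supermartingale along the run of the algorithm. -/
theorem expectENN_nashQLaw_exp_le [Fintype 𝒜] [Nonempty 𝒜] [Fintype ℬ] [Nonempty ℬ]
    (G : MarkovGame 𝒮 𝒜 ℬ) (β : ℕ → ℝ) (cce : (𝒜 → ℬ → ℝ) → (𝒜 → ℬ → ℝ) → PMF (𝒜 × ℬ))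
    (F : List (Episode 𝒮 𝒜 ℬ) → ℕ → 𝒮 × 𝒜 × ℬ × 𝒮 → ℝ)
    (hF : ∀ es h, 1 ≤ h → ∀ s, expectENN ((learnerAfter G β cce es).π h s) (fun x =>
      expectENN (G.P h s x.1 x.2) fun s' =>
        ENNReal.ofReal (Real.exp (F es h (s, x.1, x.2, s')))) ≤ 1) (K : ℕ) :
    expectENN (nashQLaw G β cce K) (fun es => ENNReal.ofReal (Real.exp (runSum F es))) ≤ 1 := by
  induction K with
  | zero => simp [nashQLaw, expectENN_pure, runSum]
  | succ K ih =>
    simp only [nashQLaw, expectENN_bind, expectENN_map]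
    -- Given the earlier episodes, the new one multiplies the exponential by a factor of conditional
    -- mean at most `1`.
    refine le_trans (expectENN_mono _ fun es => ?_) ih
    simp only [runSum_append_singleton, Real.exp_add, ENNReal.ofReal_mul (Real.exp_pos _).le]
    rw [expectENN_const_mul]
    exact (mul_le_mul_right (expectENN_episodeLaw_exp_le G _ _ (hF es) _ _ le_rfl _) _).trans
      (by rw [mul_one])

/-! ### Shape of the recorded episodes -/

/-- The entries of the episode are consecutive transitions, beginning in the given state. -/
def IsChained : 𝒮 → Episode 𝒮 𝒜 ℬ → Prop
  | _, [] => True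
  | s, x :: τ => x.1 = s ∧ IsChained x.2.2.2 τ

theorem IsChained.getElem?_succ {s : 𝒮} {e : Episode 𝒮 𝒜 ℬ} (he : IsChained s e) {i : ℕ}
    {x y : 𝒮 × 𝒜 × ℬ × 𝒮} (hx : e[i]? = some x) (hy : e[i + 1]? = some y) : y.1 = x.2.2.2 := by
  induction e generalizing s i with
  | nil => simp at hx
  | cons z τ ih =>
    cases i with
    | zero =>
      cases τ with
      | nil => simp at hy
      | cons w τ =>
        simp at hx hy
        subst hx hy
        exact he.2.1
    | succ i => exact ih he.2 (by simpa using hx) (by simpa using hy)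

theorem IsChained.getElem?_zero {s : 𝒮} {e : Episode 𝒮 𝒜 ℬ} (he : IsChained s e)
    {x : 𝒮 × 𝒜 × ℬ × 𝒮} (hx : e[0]? = some x) : x.1 = s := by
  cases e with
  | nil => simp at hx
  | cons z τ =>
    simp at hx
    subst hx
    exact he.1

theorem mem_support_episodeLaw (G : MarkovGame 𝒮 𝒜 ℬ) (π : ℕ → 𝒮 → PMF (𝒜 × ℬ)) (n : ℕ) :
    ∀ (h : ℕ) (s : 𝒮) (e : Episode 𝒮 𝒜 ℬ), e ∈ (episodeLaw G π n h s).support →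
      e.length = n ∧ IsChained s e := by
  induction n with
  | zero =>
    intro h s e he
    simp [episodeLaw] at he
    simp [he, IsChained]
  | succ n ih =>
    intro h s e he
    rw [episodeLaw, PMF.mem_support_bind_iff] at he
    obtain ⟨x, -, he⟩ := he
    rw [PMF.mem_support_bind_iff] at he
    obtain ⟨s', -, he⟩ := he
    rw [PMF.mem_support_map_iff] at he
    obtain ⟨τ, hτ, rfl⟩ := he
    obtain ⟨h1, h2⟩ := ih _ _ _ hτ
    exact ⟨by simp [h1], rfl, h2⟩

theorem mem_support_nashQLaw [Fintype 𝒜] [Nonempty 𝒜] [Fintype ℬ] [Nonempty ℬ]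
    (G : MarkovGame 𝒮 𝒜 ℬ) (β : ℕ → ℝ) (cce : (𝒜 → ℬ → ℝ) → (𝒜 → ℬ → ℝ) → PMF (𝒜 × ℬ)) (K : ℕ) :
    ∀ es ∈ (nashQLaw G β cce K).support,
      es.length = K ∧ ∀ e ∈ es, e.length = G.H ∧ IsChained G.s₁ e := by
  induction K with
  | zero => intro es hes; simp [nashQLaw] at hes; simp [hes]
  | succ K ih =>
    intro es hes
    rw [nashQLaw, PMF.mem_support_bind_iff] at hes
    obtain ⟨es', hes', he⟩ := hes
    rw [PMF.mem_support_map_iff] at he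
    obtain ⟨e, he, rfl⟩ := he
    obtain ⟨h1, h2⟩ := ih _ hes'
    refine ⟨by simp [h1], fun e' he' => ?_⟩
    rcases List.mem_append.1 he' with h | h
    · exact h2 _ h
    · rw [List.mem_singleton] at h
      subst h
      exact mem_support_episodeLaw _ _ _ _ _ _ he

/-! ### How an episode changes the learner -/

theorem setEntry_apply_self {V : Type*} (f : ℕ → 𝒮 → 𝒜 → ℬ → V) (h : ℕ) (s : 𝒮) (a : 𝒜) (b : ℬ)
    (v : V) : setEntry f h s a b v h s a b = v := by simp [setEntry]

theorem setEntry_apply_of_not {V : Type*} (f : ℕ → 𝒮 → 𝒜 → ℬ → V) (h : ℕ) (s : 𝒮) (a : 𝒜) (b : ℬ)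
    (v : V) {h' : ℕ} {s' : 𝒮} {a' : 𝒜} {b' : ℬ} (hn : ¬(h' = h ∧ s' = s ∧ a' = a ∧ b' = b)) :
    setEntry f h s a b v h' s' a' b' = f h' s' a' b' := by
  unfold setEntry
  exact if_neg hn

theorem setEntry_row_of_ne {V : Type*} (f : ℕ → 𝒮 → 𝒜 → ℬ → V) (h : ℕ) (s : 𝒮) (a : 𝒜) (b : ℬ)
    (v : V) {h' : ℕ} (hn : h' ≠ h) : setEntry f h s a b v h' = f h' := by
  funext s' a' b'
  exact setEntry_apply_of_not f h s a b v fun hh => hn hh.1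

theorem setEntry_row_congr {V : Type*} {f g : ℕ → 𝒮 → 𝒜 → ℬ → V} {h : ℕ} (s : 𝒮) (a : 𝒜) (b : ℬ)
    {v w : V} (hfg : f h = g h) (hvw : v = w) :
    setEntry f h s a b v h = setEntry g h s a b w h := by
  subst hvw
  funext s' a' b'
  simp [setEntry, hfg]

/-- Everything the learner stores about the step `h`. -/
def LearnerState.row (σ : LearnerState 𝒮 𝒜 ℬ) (h : ℕ) :
    (𝒮 → 𝒜 → ℬ → ℝ) × (𝒮 → 𝒜 → ℬ → ℝ) × (𝒮 → 𝒜 → ℬ → ℕ) × (𝒮 → PMF (𝒜 × ℬ)) :=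
  (σ.rawUp h, σ.rawLow h, σ.N h, σ.π h)

theorem LearnerState.row_eq_iff {σ τ : LearnerState 𝒮 𝒜 ℬ} {h : ℕ} : σ.row h = τ.row h ↔
    σ.rawUp h = τ.rawUp h ∧ σ.rawLow h = τ.rawLow h ∧ σ.N h = τ.N h ∧ σ.π h = τ.π h := by
  simp [LearnerState.row]

theorem LearnerState.Qup_congr {σ τ : LearnerState 𝒮 𝒜 ℬ} {h : ℕ} (H : ℕ)
    (hr : σ.rawUp h = τ.rawUp h) : σ.Qup H h = τ.Qup H h := by
  funext s a b; simp [LearnerState.Qup, hr]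

theorem LearnerState.Qlow_congr {σ τ : LearnerState 𝒮 𝒜 ℬ} {h : ℕ} (H : ℕ)
    (hr : σ.rawLow h = τ.rawLow h) : σ.Qlow H h = τ.Qlow H h := by
  funext s a b; simp [LearnerState.Qlow, hr]

theorem LearnerState.Vup_congr {σ τ : LearnerState 𝒮 𝒜 ℬ} {h : ℕ} (H : ℕ)
    (hr : σ.row h = τ.row h) : σ.Vup H h = τ.Vup H h := by
  obtain ⟨h1, -, -, h4⟩ := LearnerState.row_eq_iff.1 hr
  funext s; simp [LearnerState.Vup, LearnerState.Qup_congr H h1, h4]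

theorem LearnerState.Vlow_congr {σ τ : LearnerState 𝒮 𝒜 ℬ} {h : ℕ} (H : ℕ)
    (hr : σ.row h = τ.row h) : σ.Vlow H h = τ.Vlow H h := by
  obtain ⟨-, h2, -, h4⟩ := LearnerState.row_eq_iff.1 hr
  funext s; simp [LearnerState.Vlow, LearnerState.Qlow_congr H h2, h4]

/-! ### Bounds on the estimates -/

theorem LearnerState.Qup_mem_Icc (H : ℕ) (σ : LearnerState 𝒮 𝒜 ℬ) (h : ℕ) (s : 𝒮) (a : 𝒜) (b : ℬ) :
    σ.Qup H h s a b ∈ Set.Icc (0 : ℝ) H :=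
  ⟨le_max_left _ _, max_le (Nat.cast_nonneg H) (min_le_left _ _)⟩

theorem LearnerState.Qlow_mem_Icc (H : ℕ) (σ : LearnerState 𝒮 𝒜 ℬ) (h : ℕ) (s : 𝒮) (a : 𝒜)
    (b : ℬ) : σ.Qlow H h s a b ∈ Set.Icc (0 : ℝ) H :=
  ⟨le_max_left _ _, max_le (Nat.cast_nonneg H) (min_le_left _ _)⟩

theorem LearnerState.Vup_mem_Icc [Fintype 𝒜] [Fintype ℬ] (H : ℕ) (σ : LearnerState 𝒮 𝒜 ℬ) (h : ℕ)
    (s : 𝒮) : σ.Vup H h s ∈ Set.Icc (0 : ℝ) H := by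
  unfold LearnerState.Vup
  split_ifs
  · simp
  · exact pmfExpect_mem_Icc _ fun x => σ.Qup_mem_Icc H h s x.1 x.2

theorem LearnerState.Vlow_mem_Icc [Fintype 𝒜] [Fintype ℬ] (H : ℕ) (σ : LearnerState 𝒮 𝒜 ℬ) (h : ℕ)
    (s : 𝒮) : σ.Vlow H h s ∈ Set.Icc (0 : ℝ) H := by
  unfold LearnerState.Vlow
  split_ifs
  · simp
  · exact pmfExpect_mem_Icc _ fun x => σ.Qlow_mem_Icc H h s x.1 x.2

theorem LearnerState.Qlow_le_Qup (H : ℕ) (σ : LearnerState 𝒮 𝒜 ℬ) (h : ℕ) {s : 𝒮} {a : 𝒜} {b : ℬ}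
    (hr : σ.rawLow h s a b ≤ σ.rawUp h s a b) : σ.Qlow H h s a b ≤ σ.Qup H h s a b :=
  max_le_max le_rfl (min_le_min le_rfl hr)

/-- Truncation to an interval is monotone and 1-Lipschitz. -/
theorem LearnerState.Qup_sub_Qlow_le (H : ℕ) (σ : LearnerState 𝒮 𝒜 ℬ) (h : ℕ) {s : 𝒮} {a : 𝒜}
    {b : ℬ} (hr : σ.rawLow h s a b ≤ σ.rawUp h s a b) :
    σ.Qup H h s a b - σ.Qlow H h s a b ≤ σ.rawUp h s a b - σ.rawLow h s a b := by
  unfold LearnerState.Qup LearnerState.Qlow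
  have hH : (0 : ℝ) ≤ H := Nat.cast_nonneg H
  rcases max_cases 0 (min (H : ℝ) (σ.rawUp h s a b)) with h1 | h1 <;>
  rcases max_cases 0 (min (H : ℝ) (σ.rawLow h s a b)) with h2 | h2 <;>
  rcases min_cases (H : ℝ) (σ.rawUp h s a b) with h3 | h3 <;>
  rcases min_cases (H : ℝ) (σ.rawLow h s a b) with h4 | h4 <;>
  linarith

theorem LearnerState.Vlow_le_Vup [Fintype 𝒜] [Fintype ℬ] (H : ℕ) (σ : LearnerState 𝒮 𝒜 ℬ) (h : ℕ)
    (hr : ∀ s a b, σ.rawLow h s a b ≤ σ.rawUp h s a b) (s : 𝒮) : σ.Vlow H h s ≤ σ.Vup H h s := by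
  unfold LearnerState.Vlow LearnerState.Vup
  split_ifs
  · exact le_rfl
  · exact pmfExpect_mono _ fun x => σ.Qlow_le_Qup H h (hr s x.1 x.2)

section Learner

variable (G : MarkovGame 𝒮 𝒜 ℬ) (β : ℕ → ℝ) (cce : (𝒜 → ℬ → ℝ) → (𝒜 → ℬ → ℝ) → PMF (𝒜 × ℬ))

/-- Both updates made after the transition `x` at step `h`. -/
def LearnerState.step (σ : LearnerState 𝒮 𝒜 ℬ) (h : ℕ) (x : 𝒮 × 𝒜 × ℬ × 𝒮) : LearnerState 𝒮 𝒜 ℬ :=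
  (σ.updateQ G β h x.1 x.2.1 x.2.2.1 x.2.2.2).updatePolicy G.H cce h x.1

theorem LearnerState.row_step_of_ne (σ : LearnerState 𝒮 𝒜 ℬ) {h h' : ℕ} (x : 𝒮 × 𝒜 × ℬ × 𝒮)
    (hn : h' ≠ h) : (σ.step G β cce h x).row h' = σ.row h' := by
  rw [LearnerState.row_eq_iff]
  refine ⟨setEntry_row_of_ne _ _ _ _ _ _ hn, setEntry_row_of_ne _ _ _ _ _ _ hn,
    setEntry_row_of_ne _ _ _ _ _ _ hn, ?_⟩
  funext s
  simp [LearnerState.step, LearnerState.updatePolicy, LearnerState.updateQ, hn]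

/-- The update at step `h` reads nothing but the rows `h` and `h + 1`. -/
theorem LearnerState.row_step_congr {σ τ : LearnerState 𝒮 𝒜 ℬ} {h : ℕ} (x : 𝒮 × 𝒜 × ℬ × 𝒮)
    (h0 : σ.row h = τ.row h) (h1 : σ.row (h + 1) = τ.row (h + 1)) :
    (σ.step G β cce h x).row h = (τ.step G β cce h x).row h := by
  obtain ⟨e1, e2, e3, e4⟩ := LearnerState.row_eq_iff.1 h0
  have v1 := LearnerState.Vup_congr G.H h1
  have v2 := LearnerState.Vlow_congr G.H h1
  have r1 : (σ.updateQ G β h x.1 x.2.1 x.2.2.1 x.2.2.2).rawUp h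
      = (τ.updateQ G β h x.1 x.2.1 x.2.2.1 x.2.2.2).rawUp h :=
    setEntry_row_congr _ _ _ e1 (by simp only [e1, e3, v1])
  have r2 : (σ.updateQ G β h x.1 x.2.1 x.2.2.1 x.2.2.2).rawLow h
      = (τ.updateQ G β h x.1 x.2.1 x.2.2.1 x.2.2.2).rawLow h :=
    setEntry_row_congr _ _ _ e2 (by simp only [e2, e3, v2])
  rw [LearnerState.row_eq_iff]
  refine ⟨r1, r2, setEntry_row_congr _ _ _ e3 (by simp only [e3]), ?_⟩
  funext s
  simp only [LearnerState.step, LearnerState.updatePolicy, LearnerState.Qup_congr G.H r1,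
    LearnerState.Qlow_congr G.H r2]
  simp [LearnerState.updateQ, e4]

theorem LearnerState.row_processEpisode_of_lt (e : Episode 𝒮 𝒜 ℬ) :
    ∀ (σ : LearnerState 𝒮 𝒜 ℬ) (h h' : ℕ), h' < h →
      (LearnerState.processEpisode G β cce h e σ).row h' = σ.row h' := by
  induction e with
  | nil => intro σ h h' _; rfl
  | cons x τ ih =>
    intro σ h h' hh
    refine (ih _ (h + 1) h' (by omega)).trans ?_
    exact LearnerState.row_step_of_ne G β cce σ x hh.ne

theorem LearnerState.row_processEpisode_none (e : Episode 𝒮 𝒜 ℬ) :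
    ∀ (σ : LearnerState 𝒮 𝒜 ℬ) (h i : ℕ), e[i]? = none →
      (LearnerState.processEpisode G β cce h e σ).row (h + i) = σ.row (h + i) := by
  induction e with
  | nil => intro σ h i _; rfl
  | cons x τ ih =>
    intro σ h i hi
    cases i with
    | zero => simp at hi
    | succ i =>
      rw [show h + (i + 1) = h + 1 + i by ring]
      refine (ih _ (h + 1) i (by simpa using hi)).trans ?_
      exact LearnerState.row_step_of_ne G β cce σ x (by omega)

/-- Steps are processed in increasing order. When a step is reached, its own row and the next one,
the only rows it reads, are still those of the beginning of the episode; later steps do not touch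
its row. So the net effect on a row is a single update of the learner held at the start. -/
theorem LearnerState.row_processEpisode_some (e : Episode 𝒮 𝒜 ℬ) :
    ∀ (σ : LearnerState 𝒮 𝒜 ℬ) (h i : ℕ) (x : 𝒮 × 𝒜 × ℬ × 𝒮), e[i]? = some x →
      (LearnerState.processEpisode G β cce h e σ).row (h + i)
        = (σ.step G β cce (h + i) x).row (h + i) := by
  induction e with
  | nil => intro σ h i x hx; simp at hx
  | cons y τ ih =>
    intro σ h i x hi
    cases i with
    | zero =>
      simp at hi
      subst hi
      exact LearnerState.row_processEpisode_of_lt G β cce τ _ (h + 1) h (by omega)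
    | succ i =>
      rw [show h + (i + 1) = h + 1 + i by ring]
      refine (ih _ (h + 1) i x (by simpa using hi)).trans ?_
      exact LearnerState.row_step_congr G β cce x
        (LearnerState.row_step_of_ne G β cce σ y (by omega))
        (LearnerState.row_step_of_ne G β cce σ y (by omega))

end Learner

/-! ### The learner at the beginning of an episode -/

/-- The transition recorded at step `h` of episode `j`. -/
def entryAt (es : List (Episode 𝒮 𝒜 ℬ)) (j h : ℕ) : Option (𝒮 × 𝒜 × ℬ × 𝒮) :=
  (es.getD j [])[h - 1]?

section Run

variable [Fintype 𝒜] [Nonempty 𝒜] [Fintype ℬ] [Nonempty ℬ] (G : MarkovGame 𝒮 𝒜 ℬ) (β : ℕ → ℝ)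
  (cce : (𝒜 → ℬ → ℝ) → (𝒜 → ℬ → ℝ) → PMF (𝒜 × ℬ)) (es : List (Episode 𝒮 𝒜 ℬ))

/-- The learner at the beginning of episode number `k = 0, 1, …`. -/
def learnerAt (k : ℕ) : LearnerState 𝒮 𝒜 ℬ := learnerAfter G β cce (es.take k)

theorem learnerAt_zero : learnerAt G β cce es 0 = LearnerState.initial 𝒮 G.H := by
  simp [learnerAt, learnerAfter]

theorem learnerAt_succ (k : ℕ) : learnerAt G β cce es (k + 1)
    = LearnerState.processEpisode G β cce 1 (es.getD k []) (learnerAt G β cce es k) := by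
  unfold learnerAt learnerAfter
  by_cases hk : k < es.length
  · rw [List.take_add_one, List.foldl_append, List.getD_eq_getElem?_getD,
      List.getElem?_eq_getElem hk]
    simp
  · rw [List.getD_eq_default _ _ (by omega), List.take_of_length_le (by omega),
      List.take_of_length_le (by omega)]
    rfl

variable {es}

theorem row_learnerAt_succ_none {k h : ℕ} (hh : 1 ≤ h) (he : entryAt es k h = none) :
    (learnerAt G β cce es (k + 1)).row h = (learnerAt G β cce es k).row h := by
  rw [learnerAt_succ]
  have := LearnerState.row_processEpisode_none G β cce (es.getD k []) (learnerAt G β cce es k) 1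
    (h - 1) he
  rwa [Nat.add_sub_cancel' hh] at this

theorem row_learnerAt_succ_some {k h : ℕ} (hh : 1 ≤ h) {x : 𝒮 × 𝒜 × ℬ × 𝒮}
    (he : entryAt es k h = some x) : (learnerAt G β cce es (k + 1)).row h
      = ((learnerAt G β cce es k).step G β cce h x).row h := by
  rw [learnerAt_succ]
  have := LearnerState.row_processEpisode_some G β cce (es.getD k []) (learnerAt G β cce es k) 1
    (h - 1) x he
  rwa [Nat.add_sub_cancel' hh] at this

/-- An induction principle: a property of the rows `h` that holds initially and is preserved by the
updates holds at the beginning of every episode. -/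
theorem learnerAt_row_induction {h : ℕ} (hh : 1 ≤ h) {p : ℕ → LearnerState 𝒮 𝒜 ℬ → Prop}
    (hp : ∀ {k σ τ}, LearnerState.row σ h = τ.row h → p k σ → p k τ)
    (h0 : p 0 (LearnerState.initial 𝒮 G.H))
    (hnone : ∀ k, entryAt es k h = none → p k (learnerAt G β cce es k) →
      p (k + 1) (learnerAt G β cce es k))
    (hsome : ∀ k x, entryAt es k h = some x → p k (learnerAt G β cce es k) →
      p (k + 1) ((learnerAt G β cce es k).step G β cce h x)) (k : ℕ) :
    p k (learnerAt G β cce es k) := by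
  induction k with
  | zero => rw [learnerAt_zero]; exact h0
  | succ k ih =>
    cases he : entryAt es k h with
    | none => exact hp (row_learnerAt_succ_none G β cce hh he).symm (hnone k he ih)
    | some x => exact hp (row_learnerAt_succ_some G β cce hh he).symm (hsome k x he ih)

theorem learnerAt_succ_of_not_visited {k h : ℕ} (hh : 1 ≤ h) {s : 𝒮} {a : 𝒜} {b : ℬ}
    (he : ¬∃ s', entryAt es k h = some (s, a, b, s')) :
    (learnerAt G β cce es (k + 1)).rawUp h s a b = (learnerAt G β cce es k).rawUp h s a b ∧
    (learnerAt G β cce es (k + 1)).rawLow h s a b = (learnerAt G β cce es k).rawLow h s a b ∧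
    (learnerAt G β cce es (k + 1)).N h s a b = (learnerAt G β cce es k).N h s a b := by
  cases hx : entryAt es k h with
  | none =>
    obtain ⟨h1, h2, h3, -⟩ := LearnerState.row_eq_iff.1 (row_learnerAt_succ_none G β cce hh hx)
    rw [h1, h2, h3]
    exact ⟨rfl, rfl, rfl⟩
  | some x =>
    obtain ⟨h1, h2, h3, -⟩ := LearnerState.row_eq_iff.1 (row_learnerAt_succ_some G β cce hh hx)
    have hne : ¬(h = h ∧ s = x.1 ∧ a = x.2.1 ∧ b = x.2.2.1) := by
      rintro ⟨-, rfl, rfl, rfl⟩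
      exact he ⟨x.2.2.2, hx⟩
    rw [h1, h2, h3]
    exact ⟨setEntry_apply_of_not _ _ _ _ _ _ hne, setEntry_apply_of_not _ _ _ _ _ _ hne,
      setEntry_apply_of_not _ _ _ _ _ _ hne⟩

theorem learnerAt_succ_of_visited {k h : ℕ} (hh : 1 ≤ h) {s : 𝒮} {a : 𝒜} {b : ℬ} {s' : 𝒮}
    (hx : entryAt es k h = some (s, a, b, s')) {t : ℕ} {α : ℝ}
    (ht : t = (learnerAt G β cce es k).N h s a b + 1) (hα : α = learningRate G.H t) :
    (learnerAt G β cce es (k + 1)).rawUp h s a b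
      = (1 - α) * (learnerAt G β cce es k).rawUp h s a b
        + α * (G.r h s a b + (learnerAt G β cce es k).Vup G.H (h + 1) s' + β t) ∧
    (learnerAt G β cce es (k + 1)).rawLow h s a b
      = (1 - α) * (learnerAt G β cce es k).rawLow h s a b
        + α * (G.r h s a b + (learnerAt G β cce es k).Vlow G.H (h + 1) s' - β t) ∧
    (learnerAt G β cce es (k + 1)).N h s a b = t := by
  obtain ⟨h1, h2, h3, -⟩ := LearnerState.row_eq_iff.1 (row_learnerAt_succ_some G β cce hh hx)
  rw [h1, h2, h3, hα, ht]
  exact ⟨setEntry_apply_self _ _ _ _ _ _, setEntry_apply_self _ _ _ _ _ _,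
    setEntry_apply_self _ _ _ _ _ _⟩

/-! ### Invariants of the learner -/

/-- An update at `(h, s)` recomputes the policy from the new estimates in that state, which are
truncated to `[0, H]` as the subroutine requires. In other states neither the estimates nor the
policy at step `h` change. -/
theorem isCCE_learnerAt (hcce : IsCCESubroutine G.H cce) {h : ℕ} (hh : 1 ≤ h) (k : ℕ) (s : 𝒮) :
    IsCCE ((learnerAt G β cce es k).Qup G.H h s) ((learnerAt G β cce es k).Qlow G.H h s)
      ((learnerAt G β cce es k).π h s) := by
  refine learnerAt_row_induction G β cce (es := es) hh
    (p := fun _ σ => ∀ s, IsCCE (σ.Qup G.H h s) (σ.Qlow G.H h s) (σ.π h s)) ?_ ?_ ?_ ?_ k s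
  · intro k σ τ hr hσ s
    obtain ⟨h1, h2, -, h4⟩ := LearnerState.row_eq_iff.1 hr
    rw [← LearnerState.Qup_congr G.H h1, ← LearnerState.Qlow_congr G.H h2, ← h4]
    exact hσ s
  -- Initially both matrices are constant, so every law, in particular the uniform one, is a CCE.
  · intro s
    simp [IsCCE, LearnerState.Qup, LearnerState.Qlow, LearnerState.initial]
  · exact fun k _ hk => hk
  · intro k x _ hk s
    by_cases hs : s = x.1
    · have hπ : ((learnerAt G β cce es k).step G β cce h x).π h s
          = cce (((learnerAt G β cce es k).step G β cce h x).Qup G.H h s)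
            (((learnerAt G β cce es k).step G β cce h x).Qlow G.H h s) := by
        subst hs
        simp [LearnerState.step, LearnerState.updatePolicy]
        rfl
      rw [hπ]
      exact hcce _ _ (LearnerState.Qup_mem_Icc _ _ _ _) (LearnerState.Qlow_mem_Icc _ _ _ _)
    · have hπ : ((learnerAt G β cce es k).step G β cce h x).π h s
          = (learnerAt G β cce es k).π h s := by
        simp [LearnerState.step, LearnerState.updatePolicy, LearnerState.updateQ, hs]
      have hne : ∀ a b, ¬(h = h ∧ s = x.1 ∧ a = x.2.1 ∧ b = x.2.2.1) := fun a b hh => hs hh.2.1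
      have h1 : ((learnerAt G β cce es k).step G β cce h x).Qup G.H h s
          = (learnerAt G β cce es k).Qup G.H h s := by
        funext a b
        exact congrArg (fun v => max 0 (min (G.H : ℝ) v))
          (setEntry_apply_of_not _ _ _ _ _ _ (hne a b))
      have h2 : ((learnerAt G β cce es k).step G β cce h x).Qlow G.H h s
          = (learnerAt G β cce es k).Qlow G.H h s := by
        funext a b
        exact congrArg (fun v => max 0 (min (G.H : ℝ) v))
          (setEntry_apply_of_not _ _ _ _ _ _ (hne a b))
      rw [hπ, h1, h2]
      exact hk s

variable {β}

/-- The order holds on every record, with no concentration: both updates are monotone with the same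
rate, the two values average over the same joint policy, and the bonuses push apart. The induction
treats all steps at once since step `h` uses the order at `h + 1`. -/
theorem rawLow_le_rawUp_learnerAt (hβ : ∀ t, 0 ≤ β t) (k : ℕ) :
    ∀ {h : ℕ}, 1 ≤ h → ∀ s a b, (learnerAt G β cce es k).rawLow h s a b
      ≤ (learnerAt G β cce es k).rawUp h s a b := by
  induction k with
  | zero => intro h _ s a b; rw [learnerAt_zero]; simp [LearnerState.initial]
  | succ k ih =>
    intro h hh s a b
    by_cases hv : ∃ s', entryAt es k h = some (s, a, b, s')
    · obtain ⟨s', hv⟩ := hv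
      obtain ⟨h1, h2, -⟩ := learnerAt_succ_of_visited G β cce hh hv rfl rfl
      rw [h1, h2]
      have hα := learningRate_le_one G.H
        (Nat.le_add_left 1 ((learnerAt G β cce es k).N h s a b))
      have hα0 := learningRate_nonneg G.H ((learnerAt G β cce es k).N h s a b + 1)
      have hV := LearnerState.Vlow_le_Vup G.H (learnerAt G β cce es k) (h + 1)
        (ih (Nat.le_add_left 1 h)) s'
      have := hβ ((learnerAt G β cce es k).N h s a b + 1)
      exact add_le_add (mul_le_mul_of_nonneg_left (ih hh s a b) (by linarith))
        (mul_le_mul_of_nonneg_left (by linarith) hα0)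
    · obtain ⟨h1, h2, -⟩ := learnerAt_succ_of_not_visited G β cce hh hv
      rw [h1, h2]
      exact ih hh s a b

variable (β)

/-! ### Sums over the visits of a state-action pair -/

open Classical in
/-- The sum of `f j s'` over the episodes `j < k` in which `(s, a, b)` occurred at step `h` and led
to `s'`. -/
def visitSum (es : List (Episode 𝒮 𝒜 ℬ)) (k h : ℕ) (s : 𝒮) (a : 𝒜) (b : ℬ) (f : ℕ → 𝒮 → ℝ) : ℝ :=
  ∑ j ∈ Finset.range k, (entryAt es j h).elim 0 fun x =>
    if x.1 = s ∧ x.2.1 = a ∧ x.2.2.1 = b then f j x.2.2.2 else 0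

end Run

theorem visitSum_zero (es : List (Episode 𝒮 𝒜 ℬ)) (h : ℕ) (s : 𝒮) (a : 𝒜) (b : ℬ)
    (f : ℕ → 𝒮 → ℝ) : visitSum es 0 h s a b f = 0 := by simp [visitSum]

theorem visitSum_succ_of_visited {es : List (Episode 𝒮 𝒜 ℬ)} {k h : ℕ} {s : 𝒮} {a : 𝒜} {b : ℬ}
    {s' : 𝒮} (hx : entryAt es k h = some (s, a, b, s')) (f : ℕ → 𝒮 → ℝ) :
    visitSum es (k + 1) h s a b f = visitSum es k h s a b f + f k s' := by
  simp [visitSum, Finset.sum_range_succ, hx]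

theorem visitSum_succ_of_not_visited {es : List (Episode 𝒮 𝒜 ℬ)} {k h : ℕ} {s : 𝒮} {a : 𝒜} {b : ℬ}
    (hx : ¬∃ s', entryAt es k h = some (s, a, b, s')) (f : ℕ → 𝒮 → ℝ) :
    visitSum es (k + 1) h s a b f = visitSum es k h s a b f := by
  rw [visitSum, Finset.sum_range_succ, visitSum, add_eq_left]
  cases he : entryAt es k h with
  | none => rfl
  | some x =>
    refine if_neg ?_
    rintro ⟨rfl, rfl, rfl⟩
    exact hx ⟨x.2.2.2, he⟩

theorem visitSum_le_visitSum {es : List (Episode 𝒮 𝒜 ℬ)} {k h : ℕ} {s : 𝒮} {a : 𝒜} {b : ℬ}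
    {f g : ℕ → 𝒮 → ℝ} (hfg : ∀ j < k, ∀ s', entryAt es j h = some (s, a, b, s') → f j s' ≤ g j s') :
    visitSum es k h s a b f ≤ visitSum es k h s a b g := by
  refine Finset.sum_le_sum fun j hj => ?_
  cases he : entryAt es j h with
  | none => exact le_rfl
  | some x =>
    simp only [Option.elim_some]
    split_ifs with hx
    · obtain ⟨rfl, rfl, rfl⟩ := hx
      exact hfg j (Finset.mem_range.1 hj) _ he
    · exact le_rfl

theorem visitSum_congr {es : List (Episode 𝒮 𝒜 ℬ)} {k h : ℕ} {s : 𝒮} {a : 𝒜} {b : ℬ}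
    {f g : ℕ → 𝒮 → ℝ} (hfg : ∀ j < k, ∀ s', entryAt es j h = some (s, a, b, s') → f j s' = g j s') :
    visitSum es k h s a b f = visitSum es k h s a b g :=
  le_antisymm (visitSum_le_visitSum fun j hj s' hs => (hfg j hj s' hs).le)
    (visitSum_le_visitSum fun j hj s' hs => (hfg j hj s' hs).ge)

theorem visitSum_add (es : List (Episode 𝒮 𝒜 ℬ)) (k h : ℕ) (s : 𝒮) (a : 𝒜) (b : ℬ)
    (f g : ℕ → 𝒮 → ℝ) : visitSum es k h s a b (fun j s' => f j s' + g j s')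
      = visitSum es k h s a b f + visitSum es k h s a b g := by
  unfold visitSum
  rw [← Finset.sum_add_distrib]
  refine Finset.sum_congr rfl fun j _ => ?_
  cases entryAt es j h with
  | none => simp
  | some x => simp only [Option.elim_some]; split_ifs <;> simp

theorem visitSum_mul_left (es : List (Episode 𝒮 𝒜 ℬ)) (k h : ℕ) (s : 𝒮) (a : 𝒜) (b : ℬ)
    (c : ℝ) (f : ℕ → 𝒮 → ℝ) : visitSum es k h s a b (fun j s' => c * f j s')
      = c * visitSum es k h s a b f := by
  unfold visitSum
  rw [Finset.mul_sum]
  refine Finset.sum_congr rfl fun j _ => ?_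
  cases entryAt es j h with
  | none => simp
  | some x => simp only [Option.elim_some]; split_ifs <;> simp

theorem visitSum_sub (es : List (Episode 𝒮 𝒜 ℬ)) (k h : ℕ) (s : 𝒮) (a : 𝒜) (b : ℬ)
    (f g : ℕ → 𝒮 → ℝ) : visitSum es k h s a b (fun j s' => f j s' - g j s')
      = visitSum es k h s a b f - visitSum es k h s a b g := by
  have h1 := visitSum_add es k h s a b f fun j s' => (-1) * g j s'
  rw [visitSum_mul_left] at h1
  simpa [sub_eq_add_neg] using h1

theorem visitSum_sum {γ : Type*} (I : Finset γ) (es : List (Episode 𝒮 𝒜 ℬ)) (k h : ℕ) (s : 𝒮)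
    (a : 𝒜) (b : ℬ) (f : γ → ℕ → 𝒮 → ℝ) : visitSum es k h s a b (fun j s' => ∑ i ∈ I, f i j s')
      = ∑ i ∈ I, visitSum es k h s a b (f i) := by
  unfold visitSum
  rw [Finset.sum_comm]
  refine Finset.sum_congr rfl fun j _ => ?_
  cases entryAt es j h with
  | none => simp
  | some x => simp only [Option.elim_some]; split_ifs <;> simp

theorem visits_succ_of_visited {es : List (Episode 𝒮 𝒜 ℬ)} {k h : ℕ} {s : 𝒮} {a : 𝒜} {b : ℬ}
    {s' : 𝒮} (hx : entryAt es k h = some (s, a, b, s')) :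
    visits es (k + 1) h s a b = visits es k h s a b ++ [k] := by
  classical
  unfold visits
  have hx' : ∃ s', (es.getD k [])[h - 1]? = some (s, a, b, s') := ⟨s', hx⟩
  rw [List.range_succ, List.filter_append, List.filter_singleton, decide_eq_true hx']
  rfl

theorem visits_succ_of_not_visited {es : List (Episode 𝒮 𝒜 ℬ)} {k h : ℕ} {s : 𝒮} {a : 𝒜} {b : ℬ}
    (hx : ¬∃ s', entryAt es k h = some (s, a, b, s')) :
    visits es (k + 1) h s a b = visits es k h s a b := by
  classical
  unfold visits
  have hx' : ¬∃ s', (es.getD k [])[h - 1]? = some (s, a, b, s') := hx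
  rw [List.range_succ, List.filter_append, List.filter_singleton, decide_eq_false hx']
  exact List.append_nil _

section Run

variable [Fintype 𝒜] [Nonempty 𝒜] [Fintype ℬ] [Nonempty ℬ] (G : MarkovGame 𝒮 𝒜 ℬ) (β : ℕ → ℝ)
  (cce : (𝒜 → ℬ → ℝ) → (𝒜 → ℬ → ℝ) → PMF (𝒜 × ℬ)) {es : List (Episode 𝒮 𝒜 ℬ)}

theorem N_learnerAt_zero (h : ℕ) (s : 𝒮) (a : 𝒜) (b : ℬ) :
    (learnerAt G β cce es 0).N h s a b = 0 := by rw [learnerAt_zero]; rfl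

theorem N_learnerAt_eq_length_visits {h : ℕ} (hh : 1 ≤ h) (s : 𝒮) (a : 𝒜) (b : ℬ) (k : ℕ) :
    (learnerAt G β cce es k).N h s a b = (visits es k h s a b).length := by
  induction k with
  | zero => rw [N_learnerAt_zero]; simp [visits]
  | succ k ih =>
    by_cases hv : ∃ s', entryAt es k h = some (s, a, b, s')
    · obtain ⟨s', hv⟩ := hv
      rw [(learnerAt_succ_of_visited G β cce hh hv rfl rfl).2.2, visits_succ_of_visited hv, ih]
      simp
    · rw [(learnerAt_succ_of_not_visited G β cce hh hv).2.2, visits_succ_of_not_visited hv, ih]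

theorem N_learnerAt_mono {h : ℕ} (hh : 1 ≤ h) (s : 𝒮) (a : 𝒜) (b : ℬ) :
    Monotone fun k => (learnerAt G β cce es k).N h s a b := by
  refine monotone_nat_of_le_succ fun k => ?_
  by_cases hv : ∃ s', entryAt es k h = some (s, a, b, s')
  · obtain ⟨s', hv⟩ := hv
    simp only [(learnerAt_succ_of_visited G β cce hh hv rfl rfl).2.2, Nat.le_succ]
  · simp only [(learnerAt_succ_of_not_visited G β cce hh hv).2.2, le_rfl]

/-- If `(s, a, b)` occurred at step `h` of episode `j < k`, then its count at the beginning of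
episode `j` is below its count at the beginning of episode `k`. -/
theorem N_learnerAt_lt {h : ℕ} (hh : 1 ≤ h) {s : 𝒮} {a : 𝒜} {b : ℬ} {s' : 𝒮} {j k : ℕ} (hjk : j < k)
    (hx : entryAt es j h = some (s, a, b, s')) :
    (learnerAt G β cce es j).N h s a b < (learnerAt G β cce es k).N h s a b := by
  have h1 : (learnerAt G β cce es (j + 1)).N h s a b ≤ (learnerAt G β cce es k).N h s a b :=
    N_learnerAt_mono G β cce hh s a b hjk
  have h2 := (learnerAt_succ_of_visited G β cce hh hx rfl rfl).2.2
  omega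

/-- The position of a visit in the list `visits` equals the count of the triple when that visit
begins. This matches the index `m` of the certified policies with the learner's counter. -/
theorem sum_visits_eq_visitSum {h : ℕ} (hh : 1 ≤ h) (s : 𝒮) (a : 𝒜) (b : ℬ) (g : ℕ → ℕ → ℝ)
    (k : ℕ) : ∑ i ∈ Finset.range (visits es k h s a b).length, g i ((visits es k h s a b).getD i 0)
      = visitSum es k h s a b fun j _ => g ((learnerAt G β cce es j).N h s a b) j := by
  induction k with
  | zero => simp [visits, visitSum]
  | succ k ih =>
    by_cases hv : ∃ s', entryAt es k h = some (s, a, b, s')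
    · obtain ⟨s', hv⟩ := hv
      rw [visitSum_succ_of_visited hv, visits_succ_of_visited hv, ← ih, List.length_append,
        List.length_singleton, Finset.sum_range_succ, N_learnerAt_eq_length_visits G β cce hh]
      congr 1
      · refine Finset.sum_congr rfl fun i hi => ?_
        rw [List.getD_append _ _ _ _ (Finset.mem_range.1 hi)]
      · rw [List.getD_append_right _ _ _ _ le_rfl]
        simp
    · rw [visitSum_succ_of_not_visited hv, visits_succ_of_not_visited hv, ih]

theorem visitSum_count {h : ℕ} (hh : 1 ≤ h) (s : 𝒮) (a : 𝒜) (b : ℬ) (g : ℕ → ℝ) (k : ℕ) :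
    visitSum es k h s a b (fun j _ => g ((learnerAt G β cce es j).N h s a b))
      = ∑ i ∈ Finset.range ((learnerAt G β cce es k).N h s a b), g i := by
  rw [N_learnerAt_eq_length_visits G β cce hh,
    ← sum_visits_eq_visitSum G β cce hh s a b (fun i _ => g i)]

/-- A new visit multiplies all earlier weights by `1 - α` and gives itself weight `α`, which is the
recursion of `rateWeight`. -/
theorem raw_learnerAt_eq {h : ℕ} (hh : 1 ≤ h) (s : 𝒮) (a : 𝒜) (b : ℬ) (k : ℕ) {t : ℕ}
    (ht : t = (learnerAt G β cce es k).N h s a b) :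
    ((learnerAt G β cce es k).rawUp h s a b = (if t = 0 then (G.H : ℝ) else 0)
      + visitSum es k h s a b fun j s' =>
        rateWeight G.H t ((learnerAt G β cce es j).N h s a b + 1) *
          (G.r h s a b + (learnerAt G β cce es j).Vup G.H (h + 1) s'
            + β ((learnerAt G β cce es j).N h s a b + 1))) ∧
    (learnerAt G β cce es k).rawLow h s a b =
      visitSum es k h s a b fun j s' =>
        rateWeight G.H t ((learnerAt G β cce es j).N h s a b + 1) *
          (G.r h s a b + (learnerAt G β cce es j).Vlow G.H (h + 1) s'
            - β ((learnerAt G β cce es j).N h s a b + 1)) := by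
  induction k generalizing t with
  | zero =>
    rw [N_learnerAt_zero] at ht
    rw [visitSum_zero, visitSum_zero, learnerAt_zero]
    simp [ht, LearnerState.initial]
  | succ k ih =>
    obtain ⟨ih1, ih2⟩ := ih rfl
    by_cases hv : ∃ s', entryAt es k h = some (s, a, b, s')
    · obtain ⟨s', hv⟩ := hv
      obtain ⟨h1, h2, h3⟩ := learnerAt_succ_of_visited G β cce hh hv rfl rfl
      rw [h3] at ht
      subst ht
      have key : ∀ f : ℕ → 𝒮 → ℝ, visitSum es k h s a b (fun j s' =>
          rateWeight G.H ((learnerAt G β cce es k).N h s a b + 1)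
            ((learnerAt G β cce es j).N h s a b + 1) * f j s')
          = (1 - learningRate G.H ((learnerAt G β cce es k).N h s a b + 1)) *
            visitSum es k h s a b (fun j s' => rateWeight G.H ((learnerAt G β cce es k).N h s a b)
            ((learnerAt G β cce es j).N h s a b + 1) * f j s') := by
        intro f
        rw [← visitSum_mul_left]
        refine visitSum_congr fun j hj s'' hs => ?_
        rw [rateWeight_succ G.H (N_learnerAt_lt G β cce hh hj hs)]
        ring
      rw [h1, h2, visitSum_succ_of_visited hv, visitSum_succ_of_visited hv, key, key,
        rateWeight_self, ih1, ih2]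
      refine ⟨?_, by ring⟩
      rw [if_neg (Nat.succ_ne_zero _)]
      -- The first rate is `1`, so the initial value `H` is forgotten at the first visit.
      by_cases h0 : (learnerAt G β cce es k).N h s a b = 0
      · rw [h0, zero_add, learningRate_one]; ring
      · rw [if_neg h0]; ring
    · obtain ⟨h1, h2, h3⟩ := learnerAt_succ_of_not_visited G β cce hh hv
      rw [h3] at ht
      subst ht
      rw [h1, h2, visitSum_succ_of_not_visited hv, visitSum_succ_of_not_visited hv]
      exact ⟨ih1, ih2⟩

end Run

/-! ### Properties of the step sizes -/

/-- The sum `S` of squares obeys `S ↦ (1 - α)² S + α²` with the new rate `α`; the bound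
`learningRate` is preserved by this recursion. It is the variance proxy of the martingale sums. -/
theorem sum_sq_rateWeight_le (H t : ℕ) :
    ∑ i ∈ Finset.range t, rateWeight H t (i + 1) ^ 2 ≤ learningRate H t := by
  induction t with
  | zero => simpa using learningRate_nonneg H 0
  | succ t ih =>
    rw [Finset.sum_range_succ, rateWeight_self]
    have h1 : ∑ i ∈ Finset.range t, rateWeight H (t + 1) (i + 1) ^ 2
        = (1 - learningRate H (t + 1)) ^ 2 * ∑ i ∈ Finset.range t, rateWeight H t (i + 1) ^ 2 := by
      rw [Finset.mul_sum]
      refine Finset.sum_congr rfl fun i hi => ?_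
      rw [rateWeight_succ H (Finset.mem_range.1 hi), mul_pow]
    rw [h1]
    rcases Nat.eq_zero_or_pos t with rfl | ht
    · simp [learningRate_one]
    · have hH : (0 : ℝ) ≤ H := Nat.cast_nonneg H
      have ht' : (1 : ℝ) ≤ t := by exact_mod_cast ht
      have h2 : (1 - learningRate H (t + 1)) ^ 2 * learningRate H t
          + learningRate H (t + 1) ^ 2 ≤ learningRate H (t + 1) := by
        -- The slack in the induction step, in closed form.
        have e : learningRate H (t + 1) - learningRate H (t + 1) ^ 2
            - (1 - learningRate H (t + 1)) ^ 2 * learningRate H t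
            = (H + 1) * t * H / ((H + t) * (H + (t + 1)) ^ 2) := by
          unfold learningRate
          push_cast
          have : (H : ℝ) + t ≠ 0 := by positivity
          have : (H : ℝ) + (t + 1) ≠ 0 := by positivity
          field_simp
          ring
        have : (0 : ℝ) ≤ (H + 1) * t * H / ((H + t) * (H + (t + 1)) ^ 2) := by positivity
        linarith
      exact (add_le_add (mul_le_mul_of_nonneg_left ih (sq_nonneg _)) le_rfl).trans h2

theorem learningRate_le_div {H t : ℕ} (hH : 1 ≤ H) (ht : 1 ≤ t) :
    learningRate H t ≤ 2 * H / t := by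
  have hH' : (1 : ℝ) ≤ H := by exact_mod_cast hH
  have ht' : (1 : ℝ) ≤ t := by exact_mod_cast ht
  unfold learningRate
  rw [div_le_div_iff₀ (by positivity) (by positivity)]
  nlinarith

/-! ### Concentration of the sampled next-step values -/

section Concentration

variable [Fintype 𝒜] [Nonempty 𝒜] [Fintype ℬ] [Nonempty ℬ] (G : MarkovGame 𝒮 𝒜 ℬ) (β : ℕ → ℝ)
  (cce : (𝒜 → ℬ → ℝ) → (𝒜 → ℬ → ℝ) → PMF (𝒜 × ℬ))

open Classical in
/-- Logarithmic increments of the exponential supermartingale for the weighted sum, over the first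
`t` visits of `(s, a, b)` at step `h`, of the deviations of `W` from its conditional mean. -/
def transitionIncrement (W : LearnerState 𝒮 𝒜 ℬ → 𝒮 → ℝ) (M θ : ℝ) (t h : ℕ) (s : 𝒮) (a : 𝒜)
    (b : ℬ) (es : List (Episode 𝒮 𝒜 ℬ)) (h' : ℕ) (x : 𝒮 × 𝒜 × ℬ × 𝒮) : ℝ :=
  if h' = h ∧ x.1 = s ∧ x.2.1 = a ∧ x.2.2.1 = b ∧ (learnerAfter G β cce es).N h s a b < t then
    θ * rateWeight G.H t ((learnerAfter G β cce es).N h s a b + 1) *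
        (W (learnerAfter G β cce es) x.2.2.2
          - pmfExpect (G.P h s a b) (W (learnerAfter G β cce es)))
      - (θ * rateWeight G.H t ((learnerAfter G β cce es).N h s a b + 1)) ^ 2 * M ^ 2 / 2
  else 0

/-- The total count `t` is fixed in advance, so the weights are known before the episode. Once the
triple is reached, the next state is a fresh draw from `G.P` and Hoeffding's lemma applies; an
inactive increment is `0`. -/
theorem toOuterMeasure_transitionIncrement_le [Fintype 𝒮] (W : LearnerState 𝒮 𝒜 ℬ → 𝒮 → ℝ) {M : ℝ}
    (hW : ∀ σ s, W σ s ∈ Set.Icc 0 M) (θ : ℝ) (t h : ℕ) (s : 𝒮) (a : 𝒜) (b : ℬ) (K : ℕ) (L : ℝ) :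
    (nashQLaw G β cce K).toOuterMeasure
      {es | L < runSum (transitionIncrement G β cce W M θ t h s a b) es}
      ≤ ENNReal.ofReal (Real.exp (-L)) := by
  refine toOuterMeasure_le_exp_neg _ _ _ (expectENN_nashQLaw_exp_le G β cce _ ?_ K)
  intro es h' _ s0
  refine (expectENN_mono _ fun x => ?_).trans (expectENN_const _ 1).le
  by_cases hc : h' = h ∧ s0 = s ∧ x.1 = a ∧ x.2 = b ∧ (learnerAfter G β cce es).N h s a b < t
  · simp only [transitionIncrement, if_pos hc]
    rw [hc.1, hc.2.1, hc.2.2.1, hc.2.2.2.1]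
    exact expectENN_exp_centered_le _ (hW _) _
  · simp only [transitionIncrement, if_neg hc, Real.exp_zero, ENNReal.ofReal_one]
    rw [expectENN_const]

variable {es : List (Episode 𝒮 𝒜 ℬ)}

/-- The increments were cut off at `t` visits, so the sum over the whole run depends only on the
episodes before `k`, when the count is exactly `t`. -/
theorem runSum_transitionIncrement_eq (W : LearnerState 𝒮 𝒜 ℬ → 𝒮 → ℝ) (M θ : ℝ) {t h : ℕ}
    (hh : 1 ≤ h) {s : 𝒮} {a : 𝒜} {b : ℬ} {k : ℕ} (ht : (learnerAt G β cce es k).N h s a b = t) :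
    runSum (transitionIncrement G β cce W M θ t h s a b) es
      = θ * visitSum es k h s a b (fun j s' =>
          rateWeight G.H t ((learnerAt G β cce es j).N h s a b + 1) *
            (W (learnerAt G β cce es j) s'
              - pmfExpect (G.P h s a b) (W (learnerAt G β cce es j))))
        - θ ^ 2 * M ^ 2 / 2 * ∑ i ∈ Finset.range t, rateWeight G.H t (i + 1) ^ 2 := by
  classical
  set w : ℕ → ℝ := fun j => rateWeight G.H t ((learnerAt G β cce es j).N h s a b + 1) with hw
  set y : ℕ → 𝒮 → ℝ := fun j s' => W (learnerAt G β cce es j) s'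
    - pmfExpect (G.P h s a b) (W (learnerAt G β cce es j)) with hy
  set f : ℕ → 𝒮 → ℝ := fun j s' => if (learnerAt G β cce es j).N h s a b < t then
    θ * w j * y j s' - (θ * w j) ^ 2 * M ^ 2 / 2 else 0 with hf
  -- Only the entry at position `h - 1` of an episode can contribute. The range is extended to
  -- contain it even for short episodes.
  have h1 : ∀ n, es.length ≤ n → runSum (transitionIncrement G β cce W M θ t h s a b) es
      = visitSum es n h s a b f := by
    intro n hn
    rw [runSum_eq_sum _ es hn]
    refine Finset.sum_congr rfl fun j _ => ?_
    rw [episodeSum_eq_sum _ _ 1 (max (es.getD j []).length h) (le_max_left _ _),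
      Finset.sum_eq_single (h - 1)]
    · rw [Nat.add_sub_cancel' hh]
      change (entryAt es j h).elim 0 _ = (entryAt es j h).elim 0 _
      cases entryAt es j h with
      | none => rfl
      | some x =>
        simp only [Option.elim_some, transitionIncrement, hf, hw, hy, learnerAt]
        by_cases hx : x.1 = s ∧ x.2.1 = a ∧ x.2.2.1 = b
        · simp [hx]
        · rw [if_neg hx, if_neg]
          rintro ⟨-, h1, h2, h3, -⟩
          exact hx ⟨h1, h2, h3⟩
    · intro i _ hi
      have hne : 1 + i ≠ h := by omega
      cases (es.getD j [])[i]? with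
      | none => rfl
      | some x => simp [transitionIncrement, hne]
    · intro hi
      exact absurd (Finset.mem_range.2 (by have := le_max_right (es.getD j []).length h; omega)) hi
  -- From episode `k` on the count is at least `t`, so further visits are cut off.
  have h2 : ∀ n, k ≤ n → visitSum es n h s a b f = visitSum es k h s a b f := by
    intro n hn
    induction n, hn using Nat.le_induction with
    | base => rfl
    | succ n hn ih =>
      by_cases hv : ∃ s', entryAt es n h = some (s, a, b, s')
      · obtain ⟨s', hv⟩ := hv
        have hN : (learnerAt G β cce es k).N h s a b ≤ (learnerAt G β cce es n).N h s a b :=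
          N_learnerAt_mono G β cce hh s a b hn
        have h0 : f n s' = 0 := if_neg (by omega)
        rw [visitSum_succ_of_visited hv, ih, h0, add_zero]
      · rw [visitSum_succ_of_not_visited hv, ih]
  rw [h1 _ (le_max_left es.length k), h2 _ (le_max_right es.length k)]
  have h3 : visitSum es k h s a b f = visitSum es k h s a b fun j s' =>
      θ * (w j * y j s') - θ ^ 2 * M ^ 2 / 2 * w j ^ 2 := by
    refine visitSum_congr fun j hj s' hs => ?_
    have hlt := N_learnerAt_lt G β cce hh hj hs
    rw [hf]
    simp only
    rw [if_pos (by omega)]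
    ring
  rw [h3, visitSum_sub, visitSum_mul_left, visitSum_mul_left]
  congr 2
  rw [← ht] at hw ⊢
  rw [hw]
  exact visitSum_count G β cce hh s a b (es := es)
    (fun i => rateWeight G.H ((learnerAt G β cce es k).N h s a b) (i + 1) ^ 2) k

/-- The parameter balances the two terms of the exponent: with `u = √(ιt/H³)` and parameter `2u`,
threshold and quadratic correction are each at most `4ι`. Dividing `8ι` by `2u` gives the bound. The
sign `κ` selects the tail. -/
theorem visitSum_deviation_le {ι : ℝ} (hι : 0 < ι) (hH : 1 ≤ G.H)
    (W : LearnerState 𝒮 𝒜 ℬ → 𝒮 → ℝ) {κ : ℝ} (hκ : κ ^ 2 = 1) {t h : ℕ} (ht0 : 1 ≤ t)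
    (hh : 1 ≤ h) {s : 𝒮} {a : 𝒜} {b : ℬ} {k : ℕ} (ht : (learnerAt G β cce es k).N h s a b = t)
    (hes : runSum (transitionIncrement G β cce W G.H (κ * (2 * √(ι * t / (G.H : ℝ) ^ 3))) t h s a b)
      es ≤ 4 * ι) :
    κ * visitSum es k h s a b (fun j s' =>
          rateWeight G.H t ((learnerAt G β cce es j).N h s a b + 1) *
            (W (learnerAt G β cce es j) s'
              - pmfExpect (G.P h s a b) (W (learnerAt G β cce es j))))
      ≤ 4 * √((G.H : ℝ) ^ 3 * ι / t) := by
  rw [runSum_transitionIncrement_eq G β cce W _ _ hh ht] at hes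
  set Y := visitSum es k h s a b (fun j s' =>
          rateWeight G.H t ((learnerAt G β cce es j).N h s a b + 1) *
            (W (learnerAt G β cce es j) s'
              - pmfExpect (G.P h s a b) (W (learnerAt G β cce es j))))
  have hH' : (0 : ℝ) < G.H := by exact_mod_cast hH
  have ht' : (0 : ℝ) < t := by exact_mod_cast ht0
  have hsq := (sum_sq_rateWeight_le G.H t).trans (learningRate_le_div hH ht0)
  have hu : (0 : ℝ) < √(ι * t / (G.H : ℝ) ^ 3) := Real.sqrt_pos.2 (by positivity)
  have hu2 : √(ι * t / (G.H : ℝ) ^ 3) ^ 2 = ι * t / (G.H : ℝ) ^ 3 :=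
    Real.sq_sqrt (by positivity)
  have huv : √(ι * t / (G.H : ℝ) ^ 3) * √((G.H : ℝ) ^ 3 * ι / t) = ι := by
    rw [← Real.sqrt_mul (by positivity)]
    rw [show ι * t / (G.H : ℝ) ^ 3 * ((G.H : ℝ) ^ 3 * ι / t) = ι ^ 2 by field_simp]
    exact Real.sqrt_sq hι.le
  set u := √(ι * t / (G.H : ℝ) ^ 3)
  -- The variance proxy is `H²` times the sum of squared weights, which is at most `2H/t`.
  have hq : (κ * (2 * u)) ^ 2 * (G.H : ℝ) ^ 2 / 2 *
      ∑ i ∈ Finset.range t, rateWeight G.H t (i + 1) ^ 2 ≤ 4 * ι := by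
    rw [mul_pow, mul_pow, hκ, hu2]
    calc 1 * (2 ^ 2 * (ι * t / (G.H : ℝ) ^ 3)) * (G.H : ℝ) ^ 2 / 2 *
          ∑ i ∈ Finset.range t, rateWeight G.H t (i + 1) ^ 2
        ≤ 1 * (2 ^ 2 * (ι * t / (G.H : ℝ) ^ 3)) * (G.H : ℝ) ^ 2 / 2 * (2 * G.H / t) :=
          mul_le_mul_of_nonneg_left hsq (by positivity)
      _ = 4 * ι := by field_simp; ring
  have h1 : u * (κ * Y) ≤ u * (4 * √((G.H : ℝ) ^ 3 * ι / t)) := by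
    have e : u * (4 * √((G.H : ℝ) ^ 3 * ι / t)) = 4 * ι := by linear_combination 4 * huv
    rw [e]
    linarith
  exact le_of_mul_le_mul_left h1 hu

/-! ### Concentration of the sampled gaps -/

/-- Width of the confidence interval for the `Q`-value. -/
def LearnerState.gap (H : ℕ) (σ : LearnerState 𝒮 𝒜 ℬ) (h : ℕ) (s : 𝒮) (x : 𝒜 × ℬ) : ℝ :=
  σ.Qup H h s x.1 x.2 - σ.Qlow H h s x.1 x.2

/-- Logarithmic increments of the exponential supermartingale for the weighted sum of the deviations
of the gap at the sampled actions from its conditional mean. -/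
def gapIncrement (θ : ℝ) (es : List (Episode 𝒮 𝒜 ℬ)) (h : ℕ) (x : 𝒮 × 𝒜 × ℬ × 𝒮) : ℝ :=
  θ * (1 + 1 / (G.H : ℝ)) ^ (h - 1) *
      (pmfExpect ((learnerAfter G β cce es).π h x.1) ((learnerAfter G β cce es).gap G.H h x.1)
        - (learnerAfter G β cce es).gap G.H h x.1 (x.2.1, x.2.2.1))
    - (θ * (1 + 1 / (G.H : ℝ)) ^ (h - 1)) ^ 2 * (G.H : ℝ) ^ 2 / 2

/-- Since the order of the raw estimates is deterministic, the gap is bounded on every record, as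
the supermartingale requires. -/
theorem gap_mem_Icc (hβ : ∀ t, 0 ≤ β t) (k : ℕ) {h : ℕ} (hh : 1 ≤ h) (s : 𝒮) (x : 𝒜 × ℬ) :
    (learnerAt G β cce es k).gap G.H h s x ∈ Set.Icc (0 : ℝ) G.H := by
  have h1 := LearnerState.Qlow_le_Qup G.H (learnerAt G β cce es k) h
    (rawLow_le_rawUp_learnerAt G cce hβ k hh s x.1 x.2)
  have h2 := (learnerAt G β cce es k).Qup_mem_Icc G.H h s x.1 x.2
  have h3 := (learnerAt G β cce es k).Qlow_mem_Icc G.H h s x.1 x.2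
  unfold LearnerState.gap
  constructor <;> linarith [h2.2, h3.1]

theorem toOuterMeasure_gapIncrement_le (hβ : ∀ t, 0 ≤ β t) (θ : ℝ) (K : ℕ) (L : ℝ) :
    (nashQLaw G β cce K).toOuterMeasure {es | L < runSum (gapIncrement G β cce θ) es}
      ≤ ENNReal.ofReal (Real.exp (-L)) := by
  refine toOuterMeasure_le_exp_neg _ _ _ (expectENN_nashQLaw_exp_le G β cce _ ?_ K)
  intro es h hh s
  simp only [gapIncrement, expectENN_const]
  have hl : learnerAfter G β cce es = learnerAt G β cce es es.length := by
    rw [learnerAt, List.take_length]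
  rw [hl]
  -- The increment is mean minus sample, hence the negative parameter. The sampled action pair is
  -- the only randomness; the next state plays no role.
  have := expectENN_exp_centered_le ((learnerAt G β cce es es.length).π h s)
    (gap_mem_Icc G β cce (es := es) hβ es.length hh s) (-(θ * (1 + 1 / (G.H : ℝ)) ^ (h - 1)))
  convert this using 5 with x
  ring

end Concentration

/-! ### Expected rewards -/

theorem totalReward_nonneg (G : MarkovGame 𝒮 𝒜 ℬ) (τ : List (𝒮 × 𝒜 × ℬ)) :
    ∀ h, 0 ≤ totalReward G h τ := by
  induction τ with
  | nil => intro h; exact le_rfl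
  | cons x τ ih => intro h; exact add_nonneg (G.r_mem h x.1 x.2.1 x.2.2).1 (ih (h + 1))

section Value

variable {M L : Type*} (G : MarkovGame 𝒮 𝒜 ℬ) (μ : Procedure M 𝒮 𝒜 ℬ 𝒜) (ν : Procedure L 𝒮 𝒜 ℬ ℬ)

/-- Expected reward of `n` steps of play from step `h` on. -/
def expectedReward (n h : ℕ) (m : M) (l : L) (s : 𝒮) : ENNReal :=
  expectENN (playFrom G μ ν n h m l s) fun τ => ENNReal.ofReal (totalReward G h τ)

theorem expectedReward_zero (h : ℕ) (m : M) (l : L) (s : 𝒮) :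
    expectedReward G μ ν 0 h m l s = 0 := by
  simp [expectedReward, playFrom, expectENN_pure, totalReward]

theorem expectedReward_succ (n h : ℕ) (m : M) (l : L) (s : 𝒮) :
    expectedReward G μ ν (n + 1) h m l s =
      expectENN (μ.act h m s) fun a => expectENN (ν.act h l s) fun b =>
        expectENN (G.P h s a b) fun s' => expectENN (μ.next h m s a b) fun m' =>
          expectENN (ν.next h l s a b) fun l' =>
            ENNReal.ofReal (G.r h s a b) + expectedReward G μ ν n (h + 1) m' l' s' := by
  simp only [expectedReward, playFrom, expectENN_bind, expectENN_map, totalReward,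
    ← expectENN_const_add]
  simp only [ENNReal.ofReal_add (G.r_mem _ _ _ _).1 (totalReward_nonneg G _ _)]

theorem expectedReward_le (n : ℕ) : ∀ (h : ℕ) (m : M) (l : L) (s : 𝒮),
    expectedReward G μ ν n h m l s ≤ n := by
  induction n with
  | zero => intro h m l s; rw [expectedReward_zero]; exact zero_le
  | succ n ih =>
    intro h m l s
    rw [expectedReward_succ]
    refine le_trans (expectENN_mono _ fun a => expectENN_mono _ fun b => expectENN_mono _ fun s' =>
      expectENN_mono _ fun m' => expectENN_mono _ fun l' =>
        add_le_add (ENNReal.ofReal_le_ofReal (G.r_mem h s a b).2) (ih (h + 1) m' l' s')) ?_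
    simp only [expectENN_const]
    rw [ENNReal.ofReal_one, Nat.cast_succ, add_comm]

theorem value_eq_toReal : value G μ ν = (expectENN μ.init fun m => expectENN ν.init fun l =>
    expectedReward G μ ν G.H 1 m l G.s₁).toReal := by
  rw [value, pmfExpect_eq_toReal _ (totalReward_nonneg G · 1)]
  simp only [expectENN_bind, expectedReward]

end Value

/-! ### Optimism -/

theorem visitSum_nonneg {es : List (Episode 𝒮 𝒜 ℬ)} {k h : ℕ} {s : 𝒮} {a : 𝒜} {b : ℬ}
    {f : ℕ → 𝒮 → ℝ} (hf : ∀ j < k, ∀ s', entryAt es j h = some (s, a, b, s') → 0 ≤ f j s') :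
    0 ≤ visitSum es k h s a b f := by
  have h1 : visitSum es k h s a b (fun _ _ => (0 : ℝ)) = 0 := by
    simpa using visitSum_mul_left es k h s a b 0 (fun _ _ => 0)
  rw [← h1]
  exact visitSum_le_visitSum hf

theorem pmfExpect_visitSum [Fintype 𝒮] (p : PMF 𝒮) (es : List (Episode 𝒮 𝒜 ℬ)) (h : ℕ)
    (s : 𝒮) (a : 𝒜) (b : ℬ) (k : ℕ)
    (w : ℕ → ℝ) (V : ℕ → 𝒮 → ℝ) :
    pmfExpect p (fun s' => visitSum es k h s a b fun j _ => w j * V j s')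
      = visitSum es k h s a b fun j _ => w j * pmfExpect p (V j) := by
  simp only [pmfExpect_eq_sum, ← visitSum_mul_left, ← visitSum_sum, Finset.mul_sum]
  refine visitSum_congr fun j _ _ _ => Finset.sum_congr rfl fun x _ => by ring

section Optimism

variable [Fintype 𝒜] [Nonempty 𝒜] [Fintype ℬ] [Nonempty ℬ] (G : MarkovGame 𝒮 𝒜 ℬ)
  (β : ℕ → ℝ) (cce : (𝒜 → ℬ → ℝ) → (𝒜 → ℬ → ℝ) → PMF (𝒜 × ℬ)) {es : List (Episode 𝒮 𝒜 ℬ)}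

theorem raw_learnerAt_of_N_eq_zero {h : ℕ} (hh : 1 ≤ h) {s : 𝒮} {a : 𝒜} {b : ℬ} {k : ℕ}
    (h0 : (learnerAt G β cce es k).N h s a b = 0) :
    (learnerAt G β cce es k).rawUp h s a b = G.H ∧ (learnerAt G β cce es k).rawLow h s a b = 0 := by
  have hz : ∀ f : ℕ → 𝒮 → ℝ, visitSum es k h s a b f = 0 := by
    intro f
    have h1 : visitSum es k h s a b (fun _ _ => (0 : ℝ)) = 0 := by
      simpa using visitSum_mul_left es k h s a b 0 (fun _ _ => 0)
    rw [← h1]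
    refine visitSum_congr fun j hj s' hs => ?_
    have := N_learnerAt_lt G β cce hh hj hs
    omega
  obtain ⟨e1, e2⟩ := raw_learnerAt_eq G β cce (es := es) hh s a b k h0.symm
  rw [e1, e2, hz, hz, if_pos rfl, add_zero]
  exact ⟨rfl, rfl⟩

theorem visitSum_rateWeight {h : ℕ} (hh : 1 ≤ h) {s : 𝒮} {a : 𝒜} {b : ℬ} {k t : ℕ} (ht0 : 1 ≤ t)
    (ht : (learnerAt G β cce es k).N h s a b = t) :
    visitSum es k h s a b (fun j _ =>
      rateWeight G.H t ((learnerAt G β cce es j).N h s a b + 1)) = 1 := by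
  rw [← sum_rateWeight G.H t ht0]
  subst ht
  exact visitSum_count G β cce hh s a b
    (fun i => rateWeight G.H ((learnerAt G β cce es k).N h s a b) (i + 1)) k

/-- The redrawn memory of a certified policy reproduces the weights of the unrolled updates. Only
the values at `some` matter because there has been a visit. -/
theorem expectENN_nextIndex {h : ℕ} (hh : 1 ≤ h) {s : 𝒮} {a : 𝒜} {b : ℬ} {k t : ℕ} (ht0 : 1 ≤ t)
    (ht : (learnerAt G β cce es k).N h s a b = t) {φ : ℕ → ℝ} (hφ : ∀ j, 0 ≤ φ j)
    {f : Option ℕ → ENNReal} (hf : ∀ j, f (some j) = ENNReal.ofReal (φ j)) :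
    expectENN (nextIndex G.H es k h s a b) f = ENNReal.ofReal (visitSum es k h s a b fun j _ =>
      rateWeight G.H t ((learnerAt G β cce es j).N h s a b + 1) * φ j) := by
  have hlen := N_learnerAt_eq_length_visits G β cce (es := es) hh s a b k
  rw [ht] at hlen
  subst hlen
  rw [nextIndex, dif_pos (by omega), expectENN_map,
    ← sum_visits_eq_visitSum G β cce hh s a b
      (fun i j => rateWeight G.H (visits es k h s a b).length (i + 1) * φ j),
    ENNReal.ofReal_sum_of_nonneg fun i _ => mul_nonneg (rateWeight_nonneg _ _ _) (hφ _),
    expectENN, tsum_fintype, ← Fin.sum_univ_eq_sum_range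
      (fun i => ENNReal.ofReal
        (rateWeight G.H (visits es k h s a b).length (i + 1) * φ ((visits es k h s a b).getD i 0)))]
  refine Finset.sum_congr rfl fun i _ => ?_
  rw [hf, ENNReal.ofReal_mul (rateWeight_nonneg _ _ _), List.getD_eq_getElem _ _ i.2]
  rfl

/-- The weights average to one and the bonus decreases with the count, so the averaged past bonuses
are at least the current one. -/
theorem visitSum_bonus_ge {ι c : ℝ} (hc : 0 ≤ c) {h : ℕ} (hh : 1 ≤ h) {s : 𝒮} {a : 𝒜} {b : ℬ}
    {k t : ℕ} (ht0 : 1 ≤ t) (ht : (learnerAt G β cce es k).N h s a b = t) (hι : 0 ≤ ι) :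
    bonus G.H c ι t ≤ visitSum es k h s a b fun j _ =>
      rateWeight G.H t ((learnerAt G β cce es j).N h s a b + 1) *
        bonus G.H c ι ((learnerAt G β cce es j).N h s a b + 1) := by
  calc bonus G.H c ι t = visitSum es k h s a b fun j _ => bonus G.H c ι t *
        rateWeight G.H t ((learnerAt G β cce es j).N h s a b + 1) := by
        rw [visitSum_mul_left, visitSum_rateWeight G β cce hh ht0 ht, mul_one]
    _ ≤ _ := by
        refine visitSum_le_visitSum fun j hj s' hs => ?_
        have hlt := N_learnerAt_lt G β cce hh hj hs
        rw [mul_comm]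
        refine mul_le_mul_of_nonneg_left ?_ (rateWeight_nonneg _ _ _)
        unfold bonus
        refine mul_le_mul_of_nonneg_left (Real.sqrt_le_sqrt ?_) hc
        refine div_le_div_of_nonneg_left (by positivity) (by positivity) ?_
        exact_mod_cast (by omega : (learnerAt G β cce es j).N h s a b + 1 ≤ t)

/-- All sampled next-step values are as close to their means as the bonuses presume. -/
structure ValuesConcentrate (ι : ℝ) (es : List (Episode 𝒮 𝒜 ℬ)) : Prop where
  low : ∀ {h s a b k t}, 1 ≤ h → h ≤ G.H → 1 ≤ t → (learnerAt G β cce es k).N h s a b = t →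
    visitSum es k h s a b (fun j s' =>
      rateWeight G.H t ((learnerAt G β cce es j).N h s a b + 1) *
        ((learnerAt G β cce es j).Vlow G.H (h + 1) s'
          - pmfExpect (G.P h s a b) ((learnerAt G β cce es j).Vlow G.H (h + 1))))
      ≤ 4 * √((G.H : ℝ) ^ 3 * ι / t)
  up : ∀ {h s a b k t}, 1 ≤ h → h ≤ G.H → 1 ≤ t → (learnerAt G β cce es k).N h s a b = t →
    -visitSum es k h s a b (fun j s' =>
      rateWeight G.H t ((learnerAt G β cce es j).N h s a b + 1) *
        ((learnerAt G β cce es j).Vup G.H (h + 1) s'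
          - pmfExpect (G.P h s a b) ((learnerAt G β cce es j).Vup G.H (h + 1))))
      ≤ 4 * √((G.H : ℝ) ^ 3 * ι / t)

variable {c ι : ℝ} {G cce}

/-- In the unrolled estimate, replacing sampled next-step values by their means costs at most
`4√(H³ι/t)`. Since `4 ≤ c`, this is at most the bonus at `t`, hence at most the averaged bonuses. -/
theorem ValuesConcentrate.raw_le [Fintype 𝒮] (hes : ValuesConcentrate G (bonus G.H c ι) cce ι es)
    (hc : 4 ≤ c) (hι : 0 ≤ ι) {h : ℕ} (hh : 1 ≤ h) (hH : h ≤ G.H) {s : 𝒮} {a : 𝒜} {b : ℬ}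
    {k t : ℕ} (ht0 : 1 ≤ t) (ht : (learnerAt G (bonus G.H c ι) cce es k).N h s a b = t) :
    (learnerAt G (bonus G.H c ι) cce es k).rawLow h s a b ≤ G.r h s a b +
      pmfExpect (G.P h s a b) (fun s' => visitSum es k h s a b fun j _ =>
        rateWeight G.H t ((learnerAt G (bonus G.H c ι) cce es j).N h s a b + 1) *
          (learnerAt G (bonus G.H c ι) cce es j).Vlow G.H (h + 1) s') ∧
    G.r h s a b + pmfExpect (G.P h s a b) (fun s' => visitSum es k h s a b fun j _ =>
        rateWeight G.H t ((learnerAt G (bonus G.H c ι) cce es j).N h s a b + 1) *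
          (learnerAt G (bonus G.H c ι) cce es j).Vup G.H (h + 1) s')
      ≤ (learnerAt G (bonus G.H c ι) cce es k).rawUp h s a b := by
  obtain ⟨e1, e2⟩ := raw_learnerAt_eq G (bonus G.H c ι) cce (es := es) hh s a b k ht.symm
  rw [if_neg (by omega), zero_add] at e1
  rw [e1, e2, pmfExpect_visitSum, pmfExpect_visitSum]
  have hw := visitSum_rateWeight G (bonus G.H c ι) cce hh ht0 ht
  have hb := visitSum_bonus_ge G (bonus G.H c ι) cce (by linarith : 0 ≤ c) hh ht0 ht hι
  have hb4 : 4 * √((G.H : ℝ) ^ 3 * ι / t) ≤ bonus G.H c ι t :=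
    mul_le_mul_of_nonneg_right hc (Real.sqrt_nonneg _)
  have hl := hes.low hh hH ht0 ht
  have hu := hes.up hh hH ht0 ht
  simp only [mul_add, mul_sub, visitSum_add, visitSum_sub] at hl hu ⊢
  have hr : visitSum es k h s a b (fun j _ =>
      rateWeight G.H t ((learnerAt G (bonus G.H c ι) cce es j).N h s a b + 1) * G.r h s a b)
      = G.r h s a b := by
    simp only [mul_comm _ (G.r h s a b)]
    rw [visitSum_mul_left, hw, mul_one]
  rw [hr]
  constructor <;> linarith

/-- The lower value estimates bound the value of the certified policy of the max-player. -/
theorem ValuesConcentrate.low_le_expectedReward [Fintype 𝒮] {L : Type*} {K : ℕ} (hK : 0 < K)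
    (hes : ValuesConcentrate G (bonus G.H c ι) cce ι es) (hcce : IsCCESubroutine G.H cce)
    (hc : 4 ≤ c) (hι : 0 ≤ ι) (μ₀ : ℕ → 𝒮 → PMF 𝒜) (ν : Procedure L 𝒮 𝒜 ℬ ℬ) (n : ℕ) :
    ∀ h, 1 ≤ h → h + n = G.H + 1 → ∀ (m : Option ℕ) (l : L) (s : 𝒮),
      m.elim 0 (fun k => ENNReal.ofReal ((learnerAt G (bonus G.H c ι) cce es k).Vlow G.H h s))
        ≤ expectedReward G (certifiedMax G (bonus G.H c ι) cce K hK μ₀ es) ν n h m l s := by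
  induction n with
  | zero =>
    rintro h hh hn (_ | k) l s
    · exact zero_le
    · simp [LearnerState.Vlow, (by omega : G.H < h)]
  | succ n ih =>
    rintro h hh hn (_ | k) l s
    · exact zero_le
    have hH : h ≤ G.H := by omega
    set σ := learnerAt G (bonus G.H c ι) cce es with hσ
    -- The two players draw independently, so the opponent's action can be drawn first and then held
    -- fixed.
    rw [expectedReward_succ, expectENN_comm]
    have hQ : ∀ a b, ENNReal.ofReal ((σ k).Qlow G.H h s a b) ≤
        expectENN (G.P h s a b) fun s' => expectENN (nextIndex G.H es k h s a b) fun m' =>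
          expectENN (ν.next h l s a b) fun l' => ENNReal.ofReal (G.r h s a b) +
            expectedReward G (certifiedMax G (bonus G.H c ι) cce K hK μ₀ es) ν n (h + 1) m' l' s' :=
        by
      intro a b
      -- An unvisited triple has lower estimate `0`, so the fallback policy, about which nothing is
      -- known, does no harm.
      rcases Nat.eq_zero_or_pos ((σ k).N h s a b) with h0 | h0
      · have hz : (σ k).Qlow G.H h s a b = 0 := by
          simp [hσ, LearnerState.Qlow, (raw_learnerAt_of_N_eq_zero G (bonus G.H c ι) cce hh h0).2]
        rw [hz, ENNReal.ofReal_zero]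
        exact zero_le
      · set t := (σ k).N h s a b with ht
        refine le_trans ?_ (expectENN_mono _ fun s' => expectENN_mono _ fun m' =>
          (expectENN_const _ _).symm.le.trans (expectENN_mono _ fun l' =>
            add_le_add le_rfl (ih (h + 1) (by omega) (by omega) m' l' s')))
        simp only [expectENN_const_add]
        have hnn : ∀ s', 0 ≤ visitSum es k h s a b fun j _ =>
            rateWeight G.H t ((σ j).N h s a b + 1) * (σ j).Vlow G.H (h + 1) s' := fun s' =>
          visitSum_nonneg fun j _ _ _ => mul_nonneg (rateWeight_nonneg _ _ _)
            ((σ j).Vlow_mem_Icc G.H (h + 1) s').1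
        have hnext := fun s' => expectENN_nextIndex G (bonus G.H c ι) cce hh h0 ht.symm
          (φ := fun j => (σ j).Vlow G.H (h + 1) s')
          (f := fun m' => m'.elim 0 fun j => ENNReal.ofReal ((σ j).Vlow G.H (h + 1) s'))
          (fun j => ((σ j).Vlow_mem_Icc G.H (h + 1) s').1) (fun j => rfl)
        simp only [hnext]
        rw [expectENN_ofReal _ hnn, ← ENNReal.ofReal_add (G.r_mem _ _ _ _).1
          ((pmfExpect_const _ 0).symm.le.trans (pmfExpect_mono _ hnn))]
        refine ENNReal.ofReal_le_ofReal ?_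
        refine max_le (add_nonneg (G.r_mem _ _ _ _).1
          ((pmfExpect_const _ 0).symm.le.trans (pmfExpect_mono _ hnn))) ?_
        exact (min_le_right _ _).trans (hes.raw_le hc hι hh hH h0 ht.symm).1
    -- For each fixed reply `b`, the min-player's CCE inequality bounds `Vlow` by the mean of the
    -- lower estimate with the first action from the marginal and second action `b`.
    refine (expectENN_const (ν.act h l s) _).symm.le.trans (expectENN_mono _ fun b => ?_)
    change _ ≤ expectENN (((σ k).π h s).map Prod.fst) _
    rw [expectENN_map]
    refine le_trans ?_ (expectENN_mono _ fun x => hQ x.1 b)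
    rw [expectENN_ofReal _ (f := fun x : 𝒜 × ℬ => (σ k).Qlow G.H h s x.1 b)
      fun x => ((σ k).Qlow_mem_Icc G.H h s x.1 b).1]
    refine ENNReal.ofReal_le_ofReal ?_
    rw [LearnerState.Vlow, if_neg (by omega)]
    exact (isCCE_learnerAt G (bonus G.H c ι) cce hcce hh k s).2 b

/-- The upper value estimates bound the value of the certified policy of the min-player. -/
theorem ValuesConcentrate.expectedReward_le_up [Fintype 𝒮] {M : Type*} {K : ℕ} (hK : 0 < K)
    (hes : ValuesConcentrate G (bonus G.H c ι) cce ι es) (hcce : IsCCESubroutine G.H cce)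
    (hc : 4 ≤ c) (hι : 0 ≤ ι) (ν₀ : ℕ → 𝒮 → PMF ℬ) (μ : Procedure M 𝒮 𝒜 ℬ 𝒜) (n : ℕ) :
    ∀ h, 1 ≤ h → h + n = G.H + 1 → ∀ (m : M) (l : Option ℕ) (s : 𝒮),
      expectedReward G μ (certifiedMin G (bonus G.H c ι) cce K hK ν₀ es) n h m l s ≤
        l.elim ⊤ fun k =>
          ENNReal.ofReal ((learnerAt G (bonus G.H c ι) cce es k).Vup G.H h s) := by
  induction n with
  | zero =>
    intro h hh hn m l s
    rw [expectedReward_zero]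
    exact zero_le
  | succ n ih =>
    rintro h hh hn m (_ | k) s
    · exact le_top
    have hH : h ≤ G.H := by omega
    set σ := learnerAt G (bonus G.H c ι) cce es with hσ
    rw [expectedReward_succ]
    have hQ : ∀ a b,
        (expectENN (G.P h s a b) fun s' => expectENN (μ.next h m s a b) fun m' =>
          expectENN (nextIndex G.H es k h s a b) fun l' => ENNReal.ofReal (G.r h s a b) +
            expectedReward G μ (certifiedMin G (bonus G.H c ι) cce K hK ν₀ es) n (h + 1) m' l' s')
          ≤ ENNReal.ofReal ((σ k).Qup G.H h s a b) := by
      intro a b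
      -- The trivial bound by the number of remaining steps handles the truncation at `H` and
      -- unvisited triples, whose upper estimate is `H`.
      have hle : (expectENN (G.P h s a b) fun s' => expectENN (μ.next h m s a b) fun m' =>
          expectENN (nextIndex G.H es k h s a b) fun l' => ENNReal.ofReal (G.r h s a b) +
            expectedReward G μ (certifiedMin G (bonus G.H c ι) cce K hK ν₀ es) n (h + 1) m' l' s')
          ≤ ENNReal.ofReal (G.H : ℝ) := by
        refine le_trans (expectENN_mono _ fun s' => expectENN_mono _ fun m' =>
          expectENN_mono _ fun l' => add_le_add (ENNReal.ofReal_le_ofReal (G.r_mem h s a b).2)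
            (expectedReward_le G μ _ n (h + 1) m' l' s')) ?_
        simp only [expectENN_const]
        rw [ENNReal.ofReal_one, ENNReal.ofReal_natCast, ← Nat.cast_one, ← Nat.cast_add]
        exact_mod_cast (by omega : 1 + n ≤ G.H)
      refine le_trans ?_ (ENNReal.ofReal_le_ofReal (le_max_right _ _))
      rw [ENNReal.ofReal_min, le_min_iff]
      constructor
      · exact hle
      · rcases Nat.eq_zero_or_pos ((σ k).N h s a b) with h0 | h0
        · rw [hσ, (raw_learnerAt_of_N_eq_zero G (bonus G.H c ι) cce hh h0).1]
          exact hle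
        · set t := (σ k).N h s a b with ht
          refine le_trans (expectENN_mono _ fun s' => (expectENN_mono _ fun m' =>
            expectENN_mono _ fun l' => add_le_add le_rfl
              (ih (h + 1) (by omega) (by omega) m' l' s')).trans (expectENN_const _ _).le) ?_
          simp only [expectENN_const_add]
          have hnn : ∀ s', 0 ≤ visitSum es k h s a b fun j _ =>
              rateWeight G.H t ((σ j).N h s a b + 1) * (σ j).Vup G.H (h + 1) s' := fun s' =>
            visitSum_nonneg fun j _ _ _ => mul_nonneg (rateWeight_nonneg _ _ _)
              ((σ j).Vup_mem_Icc G.H (h + 1) s').1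
          have hnext := fun s' => expectENN_nextIndex G (bonus G.H c ι) cce hh h0 ht.symm
            (φ := fun j => (σ j).Vup G.H (h + 1) s')
            (f := fun m' => m'.elim ⊤ fun j => ENNReal.ofReal ((σ j).Vup G.H (h + 1) s'))
            (fun j => ((σ j).Vup_mem_Icc G.H (h + 1) s').1) (fun j => rfl)
          simp only [hnext]
          rw [expectENN_ofReal _ hnn, ← ENNReal.ofReal_add (G.r_mem _ _ _ _).1
            ((pmfExpect_const _ 0).symm.le.trans (pmfExpect_mono _ hnn))]
          exact ENNReal.ofReal_le_ofReal (hes.raw_le hc hι hh hH h0 ht.symm).2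
    refine (expectENN_mono _ fun a => ?_).trans (expectENN_const (μ.act h m s) _).le
    change expectENN (((σ k).π h s).map Prod.snd) _ ≤ _
    rw [expectENN_map]
    refine le_trans (expectENN_mono _ fun x => hQ a x.2) ?_
    rw [expectENN_ofReal _ (f := fun x : 𝒜 × ℬ => (σ k).Qup G.H h s a x.2)
      fun x => ((σ k).Qup_mem_Icc G.H h s a x.2).1]
    refine ENNReal.ofReal_le_ofReal ?_
    rw [LearnerState.Vup, if_neg (by omega)]
    exact (isCCE_learnerAt G (bonus G.H c ι) cce hcce hh k s).1 a

end Optimism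

/-! ### Sums over the episodes at a fixed step -/

/-- The sum of `f k` over the transitions at step `h` of the first `K` episodes. -/
def entrySum (es : List (Episode 𝒮 𝒜 ℬ)) (K h : ℕ) (f : ℕ → 𝒮 × 𝒜 × ℬ × 𝒮 → ℝ) : ℝ :=
  ∑ k ∈ Finset.range K, (entryAt es k h).elim 0 (f k)

theorem entrySum_le_entrySum {es : List (Episode 𝒮 𝒜 ℬ)} {K h : ℕ}
    {f g : ℕ → 𝒮 × 𝒜 × ℬ × 𝒮 → ℝ} (hfg : ∀ k < K, ∀ x, entryAt es k h = some x → f k x ≤ g k x) :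
    entrySum es K h f ≤ entrySum es K h g := by
  refine Finset.sum_le_sum fun k hk => ?_
  cases hx : entryAt es k h with
  | none => exact le_rfl
  | some x => exact hfg k (Finset.mem_range.1 hk) x hx

theorem entrySum_add (es : List (Episode 𝒮 𝒜 ℬ)) (K h : ℕ) (f g : ℕ → 𝒮 × 𝒜 × ℬ × 𝒮 → ℝ) :
    entrySum es K h (fun k x => f k x + g k x) = entrySum es K h f + entrySum es K h g := by
  unfold entrySum
  rw [← Finset.sum_add_distrib]
  refine Finset.sum_congr rfl fun k _ => ?_
  cases entryAt es k h <;> simp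

theorem entrySum_mul_left (es : List (Episode 𝒮 𝒜 ℬ)) (K h : ℕ) (c : ℝ)
    (f : ℕ → 𝒮 × 𝒜 × ℬ × 𝒮 → ℝ) :
    entrySum es K h (fun k x => c * f k x) = c * entrySum es K h f := by
  unfold entrySum
  rw [Finset.mul_sum]
  refine Finset.sum_congr rfl fun k _ => ?_
  cases entryAt es k h <;> simp

/-- Bounding a sum over the episodes by the growth of a potential that changes only at the visited
state-action pair. -/
theorem entrySum_le_potential [Fintype 𝒮] [Fintype 𝒜] [Fintype ℬ] {es : List (Episode 𝒮 𝒜 ℬ)}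
    {h : ℕ} {f : ℕ → 𝒮 × 𝒜 × ℬ × 𝒮 → ℝ} {g : ℕ → 𝒮 → 𝒜 → ℬ → ℝ}
    (hn : ∀ k s a b, (¬∃ s', entryAt es k h = some (s, a, b, s')) → g (k + 1) s a b = g k s a b)
    (hv : ∀ k s a b s', entryAt es k h = some (s, a, b, s') →
      f k (s, a, b, s') ≤ g (k + 1) s a b - g k s a b) (K : ℕ) :
    entrySum es K h f ≤ (∑ z : 𝒮 × 𝒜 × ℬ, g K z.1 z.2.1 z.2.2)
      - ∑ z : 𝒮 × 𝒜 × ℬ, g 0 z.1 z.2.1 z.2.2 := by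
  induction K with
  | zero => simp [entrySum]
  | succ K ih =>
    have hstep : (entryAt es K h).elim 0 (f K) ≤
        ∑ z : 𝒮 × 𝒜 × ℬ, (g (K + 1) z.1 z.2.1 z.2.2 - g K z.1 z.2.1 z.2.2) := by
      cases hx : entryAt es K h with
      | none =>
        refine (Finset.sum_eq_zero fun z _ => ?_).ge
        rw [hn K z.1 z.2.1 z.2.2 (by simp [hx]), sub_self]
      | some x =>
        rw [Finset.sum_eq_single (x.1, x.2.1, x.2.2.1)]
        · exact hv K x.1 x.2.1 x.2.2.1 x.2.2.2 hx
        · intro z _ hz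
          rw [hn K z.1 z.2.1 z.2.2, sub_self]
          rintro ⟨s', hs'⟩
          rw [hx, Option.some_inj] at hs'
          exact hz (by rw [hs'])
        · intro hh
          exact absurd (Finset.mem_univ _) hh
    rw [Finset.sum_sub_distrib] at hstep
    rw [entrySum, Finset.sum_range_succ]
    have := ih
    rw [entrySum] at this
    linarith

section Record

/-- The recorded episodes have full length and consist of consecutive transitions. -/
structure IsRecord (G : MarkovGame 𝒮 𝒜 ℬ) (K : ℕ) (es : List (Episode 𝒮 𝒜 ℬ)) : Prop where
  length_eq : es.length = K
  episode : ∀ e ∈ es, e.length = G.H ∧ IsChained G.s₁ e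

variable {G : MarkovGame 𝒮 𝒜 ℬ} {es : List (Episode 𝒮 𝒜 ℬ)} {K : ℕ}

theorem IsRecord.getD (hes : IsRecord G K es) {k : ℕ} (hk : k < K) :
    (es.getD k []).length = G.H ∧ IsChained G.s₁ (es.getD k []) := by
  have hk' : k < es.length := by rw [hes.length_eq]; exact hk
  rw [List.getD_eq_getElem _ _ hk']
  exact hes.episode _ (List.getElem_mem hk')

theorem IsRecord.exists_entryAt (hes : IsRecord G K es) {k h : ℕ} (hk : k < K) (hh : 1 ≤ h)
    (hH : h ≤ G.H) : ∃ x, entryAt es k h = some x := by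
  have : h - 1 < (es.getD k []).length := by rw [(hes.getD hk).1]; omega
  exact ⟨_, List.getElem?_eq_getElem this⟩

end Record

/-! ### Recursion over the steps for the total width of the confidence intervals -/

section Regret

variable [Fintype 𝒜] [Nonempty 𝒜] [Fintype ℬ] [Nonempty ℬ] (G : MarkovGame 𝒮 𝒜 ℬ)
  {β : ℕ → ℝ} (cce : (𝒜 → ℬ → ℝ) → (𝒜 → ℬ → ℝ) → PMF (𝒜 × ℬ)) {es : List (Episode 𝒮 𝒜 ℬ)}

/-- With width `δ`, count `N` and target `y`, the update reads `(H + N + 1) δ' = N δ + (H + 1) y`.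
Hence `(H + N) δ / H` drops by exactly `δ - (1 + 1/H) y` at each visit, and summing telescopes. The
potential starts at `H` for every triple and stays nonnegative. This replaces the usual interchange
of sums over visits and later episodes. -/
theorem entrySum_raw_sub_le [Fintype 𝒮] (hβ : ∀ t, 0 ≤ β t) (hH : 1 ≤ G.H) {h : ℕ}
    (hh : 1 ≤ h) (K : ℕ) :
    entrySum es K h (fun k x => (learnerAt G β cce es k).rawUp h x.1 x.2.1 x.2.2.1
        - (learnerAt G β cce es k).rawLow h x.1 x.2.1 x.2.2.1)
      ≤ Fintype.card (𝒮 × 𝒜 × ℬ) * G.H + (1 + 1 / (G.H : ℝ)) *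
        entrySum es K h (fun k x => ((learnerAt G β cce es k).Vup G.H (h + 1) x.2.2.2
            - (learnerAt G β cce es k).Vlow G.H (h + 1) x.2.2.2)
          + 2 * β ((learnerAt G β cce es k).N h x.1 x.2.1 x.2.2.1 + 1)) := by
  have hH' : (0 : ℝ) < G.H := by exact_mod_cast hH
  set σ := learnerAt G β cce es with hσ
  have hpot := entrySum_le_potential (es := es) (h := h)
    (f := fun k x => ((σ k).rawUp h x.1 x.2.1 x.2.2.1 - (σ k).rawLow h x.1 x.2.1 x.2.2.1) +
      (-(1 + 1 / (G.H : ℝ))) * (((σ k).Vup G.H (h + 1) x.2.2.2 - (σ k).Vlow G.H (h + 1) x.2.2.2)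
        + 2 * β ((σ k).N h x.1 x.2.1 x.2.2.1 + 1)))
    (g := fun k s a b => -((G.H + (σ k).N h s a b) / G.H *
      ((σ k).rawUp h s a b - (σ k).rawLow h s a b))) ?_ ?_ K
  · rw [entrySum_add, entrySum_mul_left] at hpot
    have h0 : ∑ z : 𝒮 × 𝒜 × ℬ, -((G.H + (σ 0).N h z.1 z.2.1 z.2.2) / (G.H : ℝ) *
        ((σ 0).rawUp h z.1 z.2.1 z.2.2 - (σ 0).rawLow h z.1 z.2.1 z.2.2))
        = -(Fintype.card (𝒮 × 𝒜 × ℬ) * G.H) := by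
      rw [hσ, learnerAt_zero]
      simp only [LearnerState.initial, Nat.cast_zero, add_zero, sub_zero, div_self hH'.ne', one_mul]
      rw [Finset.sum_const, Finset.card_univ, nsmul_eq_mul]
      ring
    have hK : ∑ z : 𝒮 × 𝒜 × ℬ, -((G.H + (σ K).N h z.1 z.2.1 z.2.2) / (G.H : ℝ) *
        ((σ K).rawUp h z.1 z.2.1 z.2.2 - (σ K).rawLow h z.1 z.2.1 z.2.2)) ≤ 0 := by
      refine Finset.sum_nonpos fun z _ => ?_
      have := rawLow_le_rawUp_learnerAt G cce (es := es) hβ K hh z.1 z.2.1 z.2.2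
      rw [← hσ] at this
      have : 0 ≤ (G.H + (σ K).N h z.1 z.2.1 z.2.2) / (G.H : ℝ) *
        ((σ K).rawUp h z.1 z.2.1 z.2.2 - (σ K).rawLow h z.1 z.2.1 z.2.2) :=
        mul_nonneg (by positivity) (by linarith)
      linarith
    linarith
  · intro k s a b hv
    obtain ⟨h1, h2, h3⟩ := learnerAt_succ_of_not_visited G β cce hh hv
    simp only [hσ, h1, h2, h3]
  · intro k s a b s' hv
    obtain ⟨h1, h2, h3⟩ := learnerAt_succ_of_visited G β cce hh hv rfl rfl
    refine le_of_eq ?_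
    simp only [hσ, h1, h2, h3]
    unfold learningRate
    push_cast
    have : (G.H : ℝ) + ((learnerAt G β cce es k).N h s a b + 1) ≠ 0 := by positivity
    field_simp
    ring

variable (β)

/-- The potential `2√N` grows by at least `1/√(N + 1)` at a visit. Cauchy-Schwarz over the triples
then uses that the counts at one step add up to at most `K`; the second potential, `-N`, shows this.
-/
theorem entrySum_inv_sqrt_le [Fintype 𝒮] {h : ℕ} (hh : 1 ≤ h) (K : ℕ) :
    entrySum es K h (fun k x => 1 / √(((learnerAt G β cce es k).N h x.1 x.2.1 x.2.2.1 + 1 : ℕ) : ℝ))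
      ≤ 2 * √(Fintype.card (𝒮 × 𝒜 × ℬ) * K) := by
  set σ := learnerAt G β cce es with hσ
  have hpot := entrySum_le_potential (es := es) (h := h)
    (f := fun k x => 1 / √(((σ k).N h x.1 x.2.1 x.2.2.1 + 1 : ℕ) : ℝ))
    (g := fun k s a b => 2 * √((σ k).N h s a b : ℝ)) ?_ ?_ K
  · have hcount := entrySum_le_potential (es := es) (h := h) (f := fun _ _ => -1)
      (g := fun k s a b => -((σ k).N h s a b : ℝ)) ?_ ?_ K
    · have hN0 : ∀ z : 𝒮 × 𝒜 × ℬ, (σ 0).N h z.1 z.2.1 z.2.2 = 0 := fun z =>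
        N_learnerAt_zero G β cce h z.1 z.2.1 z.2.2
      have hle : -(K : ℝ) ≤ entrySum es K h (fun _ _ => -1) := by
        unfold entrySum
        calc -(K : ℝ) = ∑ _k ∈ Finset.range K, (-1 : ℝ) := by simp
          _ ≤ _ := Finset.sum_le_sum fun k _ => by cases entryAt es k h <;> simp
      simp only [hN0, Nat.cast_zero, neg_zero, Real.sqrt_zero, mul_zero, Finset.sum_const_zero,
        sub_zero, Finset.sum_neg_distrib] at hpot hcount
      rw [← Finset.mul_sum] at hpot
      refine hpot.trans (mul_le_mul_of_nonneg_left ?_ zero_le_two)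
      refine Real.le_sqrt_of_sq_le ?_
      refine (sq_sum_le_card_mul_sum_sq (s := Finset.univ)).trans ?_
      rw [Finset.card_univ]
      refine mul_le_mul_of_nonneg_left ?_ (Nat.cast_nonneg _)
      simp only [Real.sq_sqrt (Nat.cast_nonneg _)]
      linarith
    · intro k s a b hv
      rw [hσ, (learnerAt_succ_of_not_visited G β cce hh hv).2.2]
    · intro k s a b s' hv
      rw [hσ, (learnerAt_succ_of_visited G β cce hh hv rfl rfl).2.2]
      push_cast
      linarith
  · intro k s a b hv
    rw [hσ, (learnerAt_succ_of_not_visited G β cce hh hv).2.2]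
  · intro k s a b s' hv
    rw [hσ, (learnerAt_succ_of_visited G β cce hh hv rfl rfl).2.2]
    simp only
    generalize (learnerAt G β cce es k).N h s a b = t
    have hu : 0 < √((t + 1 : ℕ) : ℝ) := Real.sqrt_pos.2 (by positivity)
    have hv0 : 0 ≤ √(t : ℝ) := Real.sqrt_nonneg _
    have hu2 : √((t + 1 : ℕ) : ℝ) ^ 2 = t + 1 := by
      rw [Real.sq_sqrt (by positivity), Nat.cast_succ]
    have hv2 : √(t : ℝ) ^ 2 = t := Real.sq_sqrt (by positivity)
    rw [div_le_iff₀ hu]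
    nlinarith [sq_nonneg (√((t + 1 : ℕ) : ℝ) - √(t : ℝ))]

variable {K : ℕ}

/-- Total width of the confidence intervals for the values of the states met at step `h`. -/
def totalWidth (es : List (Episode 𝒮 𝒜 ℬ)) (K h : ℕ) : ℝ :=
  entrySum es K h fun k x => (learnerAt G β cce es k).Vup G.H h x.1
    - (learnerAt G β cce es k).Vlow G.H h x.1

/-- Total deviation at step `h` of the gap at the sampled actions from its conditional mean. -/
def totalNoise (es : List (Episode 𝒮 𝒜 ℬ)) (K h : ℕ) : ℝ :=
  entrySum es K h fun k x =>
    pmfExpect ((learnerAt G β cce es k).π h x.1) ((learnerAt G β cce es k).gap G.H h x.1)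
      - (learnerAt G β cce es k).gap G.H h x.1 (x.2.1, x.2.2.1)

variable {G cce β}

/-- The state reached at step `h` is the one in which step `h + 1` is played. For `h = H` both sides
vanish because the estimates at `H + 1` are `0`. -/
theorem IsRecord.entrySum_next_eq (hes : IsRecord G K es) {h : ℕ} (hh : 1 ≤ h) (hH : h ≤ G.H) :
    entrySum es K h (fun k x => (learnerAt G β cce es k).Vup G.H (h + 1) x.2.2.2
      - (learnerAt G β cce es k).Vlow G.H (h + 1) x.2.2.2) = totalWidth G β cce es K (h + 1) := by
  refine Finset.sum_congr rfl fun k hk => ?_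
  have hk' := Finset.mem_range.1 hk
  obtain ⟨x, hx⟩ := hes.exists_entryAt hk' hh hH
  rw [hx, Option.elim_some]
  rcases hH.eq_or_lt with rfl | hlt
  · cases entryAt es k (G.H + 1) <;> simp [LearnerState.Vup, LearnerState.Vlow]
  · obtain ⟨y, hy⟩ := hes.exists_entryAt hk' (by omega : 1 ≤ h + 1) hlt
    rw [hy, Option.elim_some]
    have : y.1 = x.2.2.2 := by
      refine (hes.getD hk').2.getElem?_succ (i := h - 1) hx ?_
      rw [Nat.sub_add_cancel hh]
      exact hy
    simp only [this]

/-- The value width is the mean gap under the joint policy, that is, the sampled gap plus noise, and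
a gap is at most the raw width. The raw width is controlled by the telescoping bound, the bonuses by
the sum of inverse square roots. The `8` is `2` for `1 + 1/H ≤ 2`, `2` for the two bonuses and `2`
from that sum. -/
theorem IsRecord.totalWidth_le [Fintype 𝒮] {c ι : ℝ} (hc : 0 ≤ c) (hι : 0 ≤ ι)
    (hes : IsRecord G K es)
    {h : ℕ} (hh : 1 ≤ h) (hH : h ≤ G.H) :
    totalWidth G (bonus G.H c ι) cce es K h ≤
      (Fintype.card (𝒮 × 𝒜 × ℬ) * G.H
        + 8 * c * (√((G.H : ℝ) ^ 3 * ι) * √(Fintype.card (𝒮 × 𝒜 × ℬ) * K))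
        + totalNoise G (bonus G.H c ι) cce es K h)
      + (1 + 1 / (G.H : ℝ)) * totalWidth G (bonus G.H c ι) cce es K (h + 1) := by
  have hβ : ∀ t, 0 ≤ bonus G.H c ι t := fun t => mul_nonneg hc (Real.sqrt_nonneg _)
  have hH1 : 1 ≤ G.H := hh.trans hH
  have hH' : (1 : ℝ) ≤ G.H := by exact_mod_cast hH1
  have h1 : totalWidth G (bonus G.H c ι) cce es K h ≤
      totalNoise G (bonus G.H c ι) cce es K h + entrySum es K h (fun k x =>
        (learnerAt G (bonus G.H c ι) cce es k).rawUp h x.1 x.2.1 x.2.2.1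
        - (learnerAt G (bonus G.H c ι) cce es k).rawLow h x.1 x.2.1 x.2.2.1) := by
    rw [totalNoise, ← entrySum_add]
    refine entrySum_le_entrySum fun k _ x _ => ?_
    have hg := LearnerState.Qup_sub_Qlow_le G.H (learnerAt G (bonus G.H c ι) cce es k) h
      (rawLow_le_rawUp_learnerAt G cce (es := es) hβ k hh x.1 x.2.1 x.2.2.1)
    have hV : (learnerAt G (bonus G.H c ι) cce es k).Vup G.H h x.1
        - (learnerAt G (bonus G.H c ι) cce es k).Vlow G.H h x.1
        = pmfExpect ((learnerAt G (bonus G.H c ι) cce es k).π h x.1)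
          ((learnerAt G (bonus G.H c ι) cce es k).gap G.H h x.1) := by
      rw [LearnerState.Vup, LearnerState.Vlow, if_neg (by omega), if_neg (by omega),
        ← pmfExpect_sub]
      rfl
    rw [hV]
    unfold LearnerState.gap at *
    linarith
  have h2 := entrySum_raw_sub_le G cce (es := es) hβ hH1 hh K
  rw [entrySum_add, hes.entrySum_next_eq hh hH, entrySum_mul_left] at h2
  have h3 : entrySum es K h (fun k x => bonus G.H c ι
      ((learnerAt G (bonus G.H c ι) cce es k).N h x.1 x.2.1 x.2.2.1 + 1))
      ≤ c * √((G.H : ℝ) ^ 3 * ι) * (2 * √(Fintype.card (𝒮 × 𝒜 × ℬ) * K)) := by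
    refine le_trans (le_of_eq ?_) (mul_le_mul_of_nonneg_left
      (entrySum_inv_sqrt_le G (bonus G.H c ι) cce (es := es) hh K) (by positivity))
    rw [← entrySum_mul_left]
    congr 1
    funext k x
    rw [bonus, Real.sqrt_div (by positivity)]
    ring
  have hq : (1 + 1 / (G.H : ℝ)) ≤ 2 := by
    have : 1 / (G.H : ℝ) ≤ 1 := by rw [div_le_one (by linarith)]; exact hH'
    linarith
  have hq0 : 0 ≤ 1 + 1 / (G.H : ℝ) := by positivity
  have h4 : (1 + 1 / (G.H : ℝ)) * (2 * entrySum es K h (fun k x => bonus G.H c ι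
      ((learnerAt G (bonus G.H c ι) cce es k).N h x.1 x.2.1 x.2.2.1 + 1)))
      ≤ 2 * (2 * (c * √((G.H : ℝ) ^ 3 * ι) * (2 * √(Fintype.card (𝒮 × 𝒜 × ℬ) * K)))) := by
    refine mul_le_mul hq (by linarith) ?_ zero_le_two
    refine mul_nonneg zero_le_two (Finset.sum_nonneg fun k _ => ?_)
    cases entryAt es k h with
    | none => exact le_rfl
    | some x => exact hβ _
  rw [mul_add] at h2
  linarith

theorem le_geometric_of_le_add_mul {D E : ℕ → ℝ} {q : ℝ} (hq : 0 ≤ q) {n : ℕ}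
    (hD : ∀ i < n, D i ≤ E i + q * D (i + 1)) :
    D 0 ≤ (∑ i ∈ Finset.range n, q ^ i * E i) + q ^ n * D n := by
  induction n with
  | zero => simp
  | succ n ih =>
    have h1 := ih fun i hi => hD i (by omega)
    have h2 := mul_le_mul_of_nonneg_left (hD n (by omega)) (pow_nonneg hq n)
    rw [Finset.sum_range_succ, pow_succ]
    linarith

theorem one_add_inv_pow_le_three {H i : ℕ} (hi : i ≤ H) : (1 + 1 / (H : ℝ)) ^ i ≤ 3 := by
  rcases Nat.eq_zero_or_pos H with rfl | hH
  · have : i = 0 := by omega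
    subst this
    norm_num
  have hH' : (0 : ℝ) < H := by exact_mod_cast hH
  calc (1 + 1 / (H : ℝ)) ^ i ≤ (1 + 1 / (H : ℝ)) ^ H :=
        pow_le_pow_right₀ (by have : 0 < 1 / (H : ℝ) := by positivity
                              linarith) hi
    _ ≤ Real.exp (1 / H) ^ H := by
        refine pow_le_pow_left₀ (by positivity) ?_ _
        rw [add_comm]
        exact Real.add_one_le_exp _
    _ = Real.exp 1 := by
        rw [← Real.exp_nat_mul]
        congr 1
        field_simp
    _ ≤ 3 := by have := Real.exp_one_lt_d9; linarith

/-- A single supermartingale carries the noise of all steps with the weights produced by the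
recursion. Squared weights are at most `9`, so with `u² = ι/(KH³)` the quadratic correction over
`KH` entries is at most `9ι/2`; adding the threshold `4ι` gives less than `9ι`, which is divided by
`u`. -/
theorem IsRecord.sum_totalNoise_le {ι : ℝ} (hι : 0 < ι) (hK : 0 < K) (hH : 1 ≤ G.H)
    (hes : IsRecord G K es)
    (hbad : runSum (gapIncrement G β cce √(ι / (K * (G.H : ℝ) ^ 3))) es ≤ 4 * ι) :
    ∑ i ∈ Finset.range G.H, (1 + 1 / (G.H : ℝ)) ^ i * totalNoise G β cce es K (i + 1)
      ≤ 9 * √((G.H : ℝ) ^ 3 * ι * K) := by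
  have hH' : (0 : ℝ) < G.H := by exact_mod_cast hH
  have hK' : (0 : ℝ) < K := by exact_mod_cast hK
  have hu : (0 : ℝ) < √(ι / (K * (G.H : ℝ) ^ 3)) := Real.sqrt_pos.2 (by positivity)
  have hu2 : √(ι / (K * (G.H : ℝ) ^ 3)) ^ 2 = ι / (K * (G.H : ℝ) ^ 3) :=
    Real.sq_sqrt (by positivity)
  have huv : √(ι / (K * (G.H : ℝ) ^ 3)) * √((G.H : ℝ) ^ 3 * ι * K) = ι := by
    rw [← Real.sqrt_mul (by positivity)]
    rw [show ι / (K * (G.H : ℝ) ^ 3) * ((G.H : ℝ) ^ 3 * ι * K) = ι ^ 2 by field_simp]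
    exact Real.sqrt_sq hι.le
  set u := √(ι / (K * (G.H : ℝ) ^ 3))
  have h1 : u * ∑ i ∈ Finset.range G.H, (1 + 1 / (G.H : ℝ)) ^ i * totalNoise G β cce es K (i + 1)
      - K * (G.H * (9 * u ^ 2 * (G.H : ℝ) ^ 2 / 2)) ≤ runSum (gapIncrement G β cce u) es := by
    have e : u * ∑ i ∈ Finset.range G.H, (1 + 1 / (G.H : ℝ)) ^ i * totalNoise G β cce es K (i + 1)
        - K * (G.H * (9 * u ^ 2 * (G.H : ℝ) ^ 2 / 2))
        = ∑ k ∈ Finset.range K, ∑ i ∈ Finset.range G.H,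
          (u * ((1 + 1 / (G.H : ℝ)) ^ i * (entryAt es k (i + 1)).elim 0 (fun x =>
            pmfExpect ((learnerAt G β cce es k).π (i + 1) x.1)
                ((learnerAt G β cce es k).gap G.H (i + 1) x.1)
              - (learnerAt G β cce es k).gap G.H (i + 1) x.1 (x.2.1, x.2.2.1)))
            - 9 * u ^ 2 * (G.H : ℝ) ^ 2 / 2) := by
      simp only [Finset.sum_sub_distrib, Finset.sum_const, Finset.card_range, nsmul_eq_mul]
      rw [Finset.sum_comm]
      simp only [← Finset.mul_sum]
      rfl
    rw [e, runSum, hes.length_eq]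
    refine Finset.sum_le_sum fun k hk => ?_
    rw [episodeSum_eq_sum _ _ 1 G.H (hes.getD (Finset.mem_range.1 hk)).1.le]
    refine Finset.sum_le_sum fun i hi => ?_
    change _ ≤ (entryAt es k (i + 1)).elim 0 _
    cases entryAt es k (i + 1) with
    | none =>
      simp only [Option.elim_none, mul_zero, zero_sub, Left.neg_nonpos_iff]
      positivity
    | some x =>
      simp only [Option.elim_some, gapIncrement]
      rw [add_comm 1 i, Nat.add_sub_cancel]
      have hw := one_add_inv_pow_le_three (Finset.mem_range.1 hi).le
      have hw0 : 0 ≤ (1 + 1 / (G.H : ℝ)) ^ i := by positivity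
      have hsq : (u * (1 + 1 / (G.H : ℝ)) ^ i) ^ 2 * (G.H : ℝ) ^ 2
          ≤ (u * 3) ^ 2 * (G.H : ℝ) ^ 2 := by
        gcongr
      have hl : learnerAt G β cce es k = learnerAfter G β cce (es.take k) := rfl
      rw [← hl]
      linarith
  have h2 : (K : ℝ) * (G.H * (9 * u ^ 2 * (G.H : ℝ) ^ 2 / 2)) = 9 / 2 * ι := by
    rw [hu2]; field_simp
  have h3 : u * ∑ i ∈ Finset.range G.H, (1 + 1 / (G.H : ℝ)) ^ i * totalNoise G β cce es K (i + 1)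
      ≤ u * (9 * √((G.H : ℝ) ^ 3 * ι * K)) := by
    rw [mul_left_comm, huv]
    linarith
  exact le_of_mul_le_mul_left h3 hu

/-- The step recursion is unrolled down to step `H + 1`, where the width is zero. The noise is kept
with its exact weights, and the other errors take the bound `3`. -/
theorem IsRecord.totalWidth_one_le [Fintype 𝒮] {c ι : ℝ} (hc : 0 ≤ c) (hι : 0 < ι) (hK : 0 < K)
    (hH : 1 ≤ G.H) (hes : IsRecord G K es)
    (hbad : runSum (gapIncrement G (bonus G.H c ι) cce √(ι / (K * (G.H : ℝ) ^ 3))) es ≤ 4 * ι) :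
    totalWidth G (bonus G.H c ι) cce es K 1 ≤
      3 * (G.H * (Fintype.card (𝒮 × 𝒜 × ℬ) * G.H
        + 8 * c * (√((G.H : ℝ) ^ 3 * ι) * √(Fintype.card (𝒮 × 𝒜 × ℬ) * K))))
      + 9 * √((G.H : ℝ) ^ 3 * ι * K) := by
  set A := Fintype.card (𝒮 × 𝒜 × ℬ) * (G.H : ℝ)
        + 8 * c * (√((G.H : ℝ) ^ 3 * ι) * √(Fintype.card (𝒮 × 𝒜 × ℬ) * K)) with hA
  have hA0 : 0 ≤ A := by positivity
  have h1 := le_geometric_of_le_add_mul (n := G.H) (q := 1 + 1 / (G.H : ℝ)) (by positivity)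
    (D := fun i => totalWidth G (bonus G.H c ι) cce es K (i + 1))
    (E := fun i => A + totalNoise G (bonus G.H c ι) cce es K (i + 1))
    fun i hi => hes.totalWidth_le hc hι.le (by omega) (by omega)
  have h0 : totalWidth G (bonus G.H c ι) cce es K (G.H + 1) = 0 := by
    unfold totalWidth entrySum
    refine Finset.sum_eq_zero fun k _ => ?_
    cases entryAt es k (G.H + 1) <;> simp [LearnerState.Vup, LearnerState.Vlow]
  simp only [h0, mul_zero, add_zero, mul_add, Finset.sum_add_distrib, zero_add] at h1
  have h2 : ∑ i ∈ Finset.range G.H, (1 + 1 / (G.H : ℝ)) ^ i * A ≤ 3 * (G.H * A) := by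
    calc ∑ i ∈ Finset.range G.H, (1 + 1 / (G.H : ℝ)) ^ i * A
        ≤ ∑ _i ∈ Finset.range G.H, 3 * A := Finset.sum_le_sum fun i hi =>
          mul_le_mul_of_nonneg_right (one_add_inv_pow_le_three (Finset.mem_range.1 hi).le) hA0
      _ = 3 * (G.H * A) := by
          rw [Finset.sum_const, Finset.card_range, nsmul_eq_mul]; ring
  have h3 := hes.sum_totalNoise_le hι hK hH hbad
  linarith

theorem IsRecord.totalWidth_one_eq (hes : IsRecord G K es) (hH : 1 ≤ G.H) :
    totalWidth G β cce es K 1 = ∑ k ∈ Finset.range K,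
      ((learnerAt G β cce es k).Vup G.H 1 G.s₁ - (learnerAt G β cce es k).Vlow G.H 1 G.s₁) := by
  unfold totalWidth entrySum
  refine Finset.sum_congr rfl fun k hk => ?_
  obtain ⟨x, hx⟩ := hes.exists_entryAt (Finset.mem_range.1 hk) le_rfl hH
  rw [hx, Option.elim_some]
  simp only [(hes.getD (Finset.mem_range.1 hk)).2.getElem?_zero hx]

end Regret

/-! ### Values against all general policies -/

theorem measurable_expectENN {α : Type*} [Countable α] {p : ℝ → PMF α} {f : ℝ → α → ENNReal}
    (hp : ∀ x, Measurable fun z => p z x) (hf : ∀ x, Measurable fun z => f z x) :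
    Measurable fun z => expectENN (p z) (f z) :=
  Measurable.tsum fun x => (hp x).mul (hf x)

theorem measurable_expectedReward_atSeed [Countable 𝒮] [Countable 𝒜] [Countable ℬ] {M : Type*}
    [Countable M] (G : MarkovGame 𝒮 𝒜 ℬ) (μ : Procedure M 𝒮 𝒜 ℬ 𝒜) (ν : GeneralPolicy 𝒮 𝒜 ℬ ℬ)
    (n : ℕ) : ∀ h m l s, Measurable fun z => expectedReward G μ (ν.atSeed G z) n h m l s := by
  induction n with
  | zero => intro h m l s; simp only [expectedReward_zero]; exact measurable_const
  | succ n ih =>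
    intro h m l s
    simp only [expectedReward_succ]
    refine measurable_expectENN (fun _ => measurable_const) fun a => ?_
    refine measurable_expectENN (fun b => ν.measurable_act l s b) fun b => ?_
    refine measurable_expectENN (fun _ => measurable_const) fun s' => ?_
    refine measurable_expectENN (fun _ => measurable_const) fun m' => ?_
    simp only [GeneralPolicy.atSeed, expectENN_pure]
    exact (ih (h + 1) m' _ s').const_add _

instance {𝒳 : Type*} [Nonempty 𝒳] : Nonempty (GeneralPolicy 𝒮 𝒜 ℬ 𝒳) :=
  ⟨⟨MeasureTheory.Measure.dirac 0, inferInstance, fun _ _ _ => PMF.pure (Classical.arbitrary 𝒳),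
    fun _ _ _ => measurable_const⟩⟩

/-- A bound for every value of the seed integrates to a bound for the policy. Here integrability of
the value in the seed is really needed, since a non-integrable function would have integral `0`;
hence the countability assumptions. -/
theorem le_valueBestMin [Countable 𝒮] [Countable 𝒜] [Countable ℬ] [Nonempty ℬ] {M : Type*}
    [Countable M] (G : MarkovGame 𝒮 𝒜 ℬ) (μ : Procedure M 𝒮 𝒜 ℬ 𝒜) {v : ℝ}
    (hv : ∀ (ν : GeneralPolicy 𝒮 𝒜 ℬ ℬ) (z : ℝ), ENNReal.ofReal v ≤ expectENN μ.init fun m =>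
      expectedReward G μ (ν.atSeed G z) G.H 1 m [] G.s₁) : v ≤ valueBestMin G μ := by
  refine le_ciInf fun ν => ?_
  have := ν.isProb
  have hval : ∀ z, value G μ (ν.atSeed G z) = (expectENN μ.init fun m =>
      expectedReward G μ (ν.atSeed G z) G.H 1 m [] G.s₁).toReal := fun z => by
    rw [value_eq_toReal]
    simp only [GeneralPolicy.atSeed, expectENN_pure]
  have hle : ∀ z, (expectENN μ.init fun m =>
      expectedReward G μ (ν.atSeed G z) G.H 1 m [] G.s₁) ≤ G.H := fun z => by
    refine (expectENN_mono _ fun m => expectedReward_le G μ (ν.atSeed G z) _ _ m _ _).trans ?_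
    rw [expectENN_const]
  have hlow : ∀ z, v ≤ value G μ (ν.atSeed G z) := fun z => by
    rw [hval]
    exact (ENNReal.ofReal_le_iff_le_toReal
      ((hle z).trans_lt (ENNReal.natCast_lt_top _)).ne).1 (hv ν z)
  have hmeas : Measurable fun z => value G μ (ν.atSeed G z) := by
    simp only [hval]
    exact (measurable_expectENN (fun _ => measurable_const) fun m =>
      measurable_expectedReward_atSeed G μ ν _ _ m _ _).ennreal_toReal
  have hint : MeasureTheory.Integrable (fun z => value G μ (ν.atSeed G z)) ν.seedLaw := by
    refine MeasureTheory.Integrable.of_bound hmeas.aestronglyMeasurable (G.H : ℝ)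
      (Filter.Eventually.of_forall fun z => ?_)
    rw [hval, Real.norm_of_nonneg ENNReal.toReal_nonneg]
    exact ENNReal.toReal_le_of_le_ofReal (Nat.cast_nonneg _)
      ((hle z).trans (ENNReal.ofReal_natCast _).ge)
  calc v = ∫ _z, v ∂ν.seedLaw := by simp
    _ ≤ _ := MeasureTheory.integral_mono (MeasureTheory.integrable_const v) hint hlow

/-- No measurability is needed in this direction: an integral of a nonnegative function, even if it
defaults to `0`, stays below that of the constant. -/
theorem valueBestMax_le [Nonempty 𝒜] {L : Type*} (G : MarkovGame 𝒮 𝒜 ℬ) (ν : Procedure L 𝒮 𝒜 ℬ ℬ)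
    {v : ℝ} (hv0 : 0 ≤ v) (hv : ∀ (μ : GeneralPolicy 𝒮 𝒜 ℬ 𝒜) (z : ℝ), (expectENN ν.init fun l =>
      expectedReward G (μ.atSeed G z) ν G.H 1 [] l G.s₁) ≤ ENNReal.ofReal v) :
    valueBestMax G ν ≤ v := by
  refine ciSup_le fun μ => ?_
  have := μ.isProb
  have hval : ∀ z, value G (μ.atSeed G z) ν = (expectENN ν.init fun l =>
      expectedReward G (μ.atSeed G z) ν G.H 1 [] l G.s₁).toReal := fun z => by
    rw [value_eq_toReal]
    simp only [GeneralPolicy.atSeed, expectENN_pure]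
  calc ∫ z, value G (μ.atSeed G z) ν ∂μ.seedLaw ≤ ∫ _z, v ∂μ.seedLaw := by
        refine MeasureTheory.integral_mono_of_nonneg (Filter.Eventually.of_forall fun z => ?_)
          (MeasureTheory.integrable_const v) (Filter.Eventually.of_forall fun z => ?_)
        · simp only [hval, Pi.zero_apply]; exact ENNReal.toReal_nonneg
        · simp only [hval]; exact ENNReal.toReal_le_of_le_ofReal hv0 (hv μ z)
    _ = v := by simp

theorem expectENN_uniformIndex {K : ℕ} (hK : 0 < K) {φ : ℕ → ℝ} (hφ : ∀ k, 0 ≤ φ k)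
    {f : Option ℕ → ENNReal} (hf : ∀ k, f (some k) = ENNReal.ofReal (φ k)) :
    expectENN (uniformIndex K hK) f = ENNReal.ofReal ((∑ k ∈ Finset.range K, φ k) / K) := by
  have : Nonempty (Fin K) := ⟨⟨0, hK⟩⟩
  change expectENN (((PMF.uniformOfFintype (Fin K)).bind fun k => PMF.pure (k : ℕ)).map some) f = _
  simp only [expectENN_map, expectENN_bind, expectENN_pure, hf]
  rw [expectENN_ofReal _ fun k : Fin K => hφ k, pmfExpect_eq_sum]
  simp only [PMF.uniformOfFintype_apply, Fintype.card_fin, ENNReal.toReal_inv,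
    ENNReal.toReal_natCast]
  rw [← Finset.mul_sum, Fin.sum_univ_eq_sum_range (fun k => φ k), div_eq_inv_mul]

theorem value_of_subsingleton [Subsingleton 𝒜] [Subsingleton ℬ] {G : MarkovGame 𝒮 𝒜 ℬ}
    (hH : G.H = 1) {M L : Type*} (μ : Procedure M 𝒮 𝒜 ℬ 𝒜) (ν : Procedure L 𝒮 𝒜 ℬ ℬ) (a₀ : 𝒜)
    (b₀ : ℬ) : value G μ ν = G.r 1 G.s₁ a₀ b₀ := by
  have hr : ∀ a b, ENNReal.ofReal (G.r 1 G.s₁ a b) = ENNReal.ofReal (G.r 1 G.s₁ a₀ b₀) := by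
    intro a b
    rw [Subsingleton.elim a a₀, Subsingleton.elim b b₀]
  rw [value_eq_toReal, hH]
  simp only [expectedReward_succ, expectedReward_zero, add_zero, hr, expectENN_const]
  exact ENNReal.toReal_ofReal (G.r_mem _ _ _ _).1

/-- In a one-step game with a single action for each player all policies are in equilibrium. -/
theorem isApproxNash_of_subsingleton [Nonempty 𝒜] [Nonempty ℬ] [Subsingleton 𝒜] [Subsingleton ℬ]
    {G : MarkovGame 𝒮 𝒜 ℬ} (hH : G.H = 1) {M L : Type*} (μ : Procedure M 𝒮 𝒜 ℬ 𝒜)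
    (ν : Procedure L 𝒮 𝒜 ℬ ℬ) {ε : ℝ} (hε : 0 ≤ ε) : IsApproxNash G ε μ ν := by
  have a₀ : 𝒜 := Classical.arbitrary 𝒜
  have b₀ : ℬ := Classical.arbitrary ℬ
  have h1 : valueBestMax G ν = G.r 1 G.s₁ a₀ b₀ := by
    unfold valueBestMax
    simp only [value_of_subsingleton hH _ _ a₀ b₀]
    refine (iSup_congr fun μ' => ?_).trans ciSup_const
    have := μ'.isProb
    simp
  have h2 : valueBestMin G μ = G.r 1 G.s₁ a₀ b₀ := by
    unfold valueBestMin
    simp only [value_of_subsingleton hH _ _ a₀ b₀]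
    refine (iInf_congr fun ν' => ?_).trans ciInf_const
    have := ν'.isProb
    simp
  rw [IsApproxNash, h1, h2, sub_self]
  exact hε

/-- Ensures that a union bound over at most `K` counts covers all of them, for every `k`, since the
learner is constant once the record is exhausted. -/
theorem N_learnerAt_le_length [Fintype 𝒜] [Nonempty 𝒜] [Fintype ℬ] [Nonempty ℬ]
    (G : MarkovGame 𝒮 𝒜 ℬ) (β : ℕ → ℝ) (cce : (𝒜 → ℬ → ℝ) → (𝒜 → ℬ → ℝ) → PMF (𝒜 × ℬ))
    (es : List (Episode 𝒮 𝒜 ℬ)) {h : ℕ} (hh : 1 ≤ h) (s : 𝒮) (a : 𝒜) (b : ℬ) (k : ℕ) :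
    (learnerAt G β cce es k).N h s a b ≤ es.length := by
  have hmin : learnerAt G β cce es k = learnerAt G β cce es (min k es.length) := by
    rcases le_total k es.length with hk | hk
    · rw [min_eq_left hk]
    · rw [min_eq_right hk, learnerAt, learnerAt, List.take_of_length_le hk, List.take_length]
  rw [hmin, N_learnerAt_eq_length_visits G β cce hh]
  refine le_trans ?_ (min_le_right k es.length)
  unfold visits
  exact (List.length_filter_le _ _).trans (List.length_range).le

/-! ### From concentration to equilibrium, and the bad events -/

section Final

variable [Fintype 𝒜] [Nonempty 𝒜] [Fintype ℬ] [Nonempty ℬ] {G : MarkovGame 𝒮 𝒜 ℬ}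
  {cce : (𝒜 → ℬ → ℝ) → (𝒜 → ℬ → ℝ) → PMF (𝒜 × ℬ)} {es : List (Episode 𝒮 𝒜 ℬ)} {c ι ε : ℝ} {K : ℕ}

/-- Optimism at step `1`, averaged over the uniform index, places the two best-response values
between the averages of `Vlow` and `Vup`. -/
theorem ValuesConcentrate.isApproxNash [Fintype 𝒮] (hK : 0 < K)
    (hes : ValuesConcentrate G (bonus G.H c ι) cce ι es) (hcce : IsCCESubroutine G.H cce)
    (hc : 4 ≤ c) (hι : 0 ≤ ι) (μ₀ : ℕ → 𝒮 → PMF 𝒜) (ν₀ : ℕ → 𝒮 → PMF ℬ)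
    (hε : ∑ k ∈ Finset.range K, ((learnerAt G (bonus G.H c ι) cce es k).Vup G.H 1 G.s₁
      - (learnerAt G (bonus G.H c ι) cce es k).Vlow G.H 1 G.s₁) ≤ K * ε) :
    IsApproxNash G ε (certifiedMax G (bonus G.H c ι) cce K hK μ₀ es)
      (certifiedMin G (bonus G.H c ι) cce K hK ν₀ es) := by
  set σ := learnerAt G (bonus G.H c ι) cce es with hσ
  have hK' : (0 : ℝ) < K := by exact_mod_cast hK
  have h1 : (∑ k ∈ Finset.range K, (σ k).Vlow G.H 1 G.s₁) / K
      ≤ valueBestMin G (certifiedMax G (bonus G.H c ι) cce K hK μ₀ es) := by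
    refine le_valueBestMin G _ fun ν z => ?_
    rw [← expectENN_uniformIndex hK (fun k => ((σ k).Vlow_mem_Icc G.H 1 G.s₁).1)
      (f := fun m => m.elim 0 fun k => ENNReal.ofReal ((σ k).Vlow G.H 1 G.s₁)) fun k => rfl]
    exact expectENN_mono _ fun m =>
      hes.low_le_expectedReward hK hcce hc hι μ₀ _ G.H 1 le_rfl (add_comm _ _) m _ _
  have h2 : valueBestMax G (certifiedMin G (bonus G.H c ι) cce K hK ν₀ es)
      ≤ (∑ k ∈ Finset.range K, (σ k).Vup G.H 1 G.s₁) / K := by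
    refine valueBestMax_le G _ (div_nonneg (Finset.sum_nonneg fun k _ =>
      ((σ k).Vup_mem_Icc G.H 1 G.s₁).1) hK'.le) fun μ z => ?_
    rw [← expectENN_uniformIndex hK (fun k => ((σ k).Vup_mem_Icc G.H 1 G.s₁).1)
      (f := fun m => m.elim ⊤ fun k => ENNReal.ofReal ((σ k).Vup G.H 1 G.s₁)) fun k => rfl]
    exact expectENN_mono _ fun m =>
      hes.expectedReward_le_up hK hcce hc hι ν₀ _ G.H 1 le_rfl (add_comm _ _) _ m _
  have h3 : (∑ k ∈ Finset.range K, (σ k).Vup G.H 1 G.s₁) / K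
      - (∑ k ∈ Finset.range K, (σ k).Vlow G.H 1 G.s₁) / K ≤ ε := by
    rw [← sub_div, ← Finset.sum_sub_distrib, div_le_iff₀ hK', mul_comm ε]
    exact hε
  unfold IsApproxNash
  linarith

/-- Everything that can go wrong: a deviation of the sampled gaps, or of the sampled next-step
values of one of the estimates at a given number of visits of a state-action pair. -/
def badEvent (G : MarkovGame 𝒮 𝒜 ℬ) (β : ℕ → ℝ)
    (cce : (𝒜 → ℬ → ℝ) → (𝒜 → ℬ → ℝ) → PMF (𝒜 × ℬ)) (ι : ℝ) (K : ℕ) :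
    Option (Fin G.H × (𝒮 × 𝒜 × ℬ) × Fin K × Bool) → Set (List (Episode 𝒮 𝒜 ℬ))
  | none => {es | 4 * ι < runSum (gapIncrement G β cce √(ι / (K * (G.H : ℝ) ^ 3))) es}
  | some (h, z, t, true) => {es | 4 * ι < runSum (transitionIncrement G β cce
      (fun σ => σ.Vup G.H (h + 1 + 1)) G.H
      (-1 * (2 * √(ι * ((t + 1 : ℕ) : ℝ) / (G.H : ℝ) ^ 3))) (t + 1) (h + 1) z.1 z.2.1 z.2.2) es}
  | some (h, z, t, false) => {es | 4 * ι < runSum (transitionIncrement G β cce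
      (fun σ => σ.Vlow G.H (h + 1 + 1)) G.H
      (1 * (2 * √(ι * ((t + 1 : ℕ) : ℝ) / (G.H : ℝ) ^ 3))) (t + 1) (h + 1) z.1 z.2.1 z.2.2) es}

theorem toOuterMeasure_badEvent_le [Fintype 𝒮] {β : ℕ → ℝ} (hβ : ∀ t, 0 ≤ β t)
    (i : Option (Fin G.H × (𝒮 × 𝒜 × ℬ) × Fin K × Bool)) :
    (nashQLaw G β cce K).toOuterMeasure (badEvent G β cce ι K i)
      ≤ ENNReal.ofReal (Real.exp (-(4 * ι))) := by
  rcases i with _ | ⟨h, z, t, _ | _⟩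
  · exact toOuterMeasure_gapIncrement_le G β cce hβ _ K _
  · exact toOuterMeasure_transitionIncrement_le G β cce _ (fun σ s => σ.Vlow_mem_Icc _ _ s) _ _ _ _
      _ _ K _
  · exact toOuterMeasure_transitionIncrement_le G β cce _ (fun σ s => σ.Vup_mem_Icc _ _ s) _ _ _ _
      _ _ K _

theorem valuesConcentrate_of_notMem_badEvent {β : ℕ → ℝ} (hι : 0 < ι) (hlen : es.length = K)
    (hes : ∀ i, es ∉ badEvent G β cce ι K i) : ValuesConcentrate G β cce ι es := by
  constructor
  · intro h s a b k t hh hH ht0 ht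
    have htK : t ≤ K := by
      rw [← ht, ← hlen]; exact N_learnerAt_le_length G β cce es hh s a b k
    -- Bad events are indexed from zero, both in the step and in the number of visits.
    have hb := hes (some (⟨h - 1, by omega⟩, (s, a, b), ⟨t - 1, by omega⟩, false))
    simp only [badEvent, Set.mem_ofPred_eq, not_lt, Nat.sub_add_cancel hh,
      Nat.sub_add_cancel ht0] at hb
    simpa only [one_mul] using
      visitSum_deviation_le G β cce hι (hh.trans hH) _ (by norm_num) ht0 hh ht hb
  · intro h s a b k t hh hH ht0 ht
    have htK : t ≤ K := by
      rw [← ht, ← hlen]; exact N_learnerAt_le_length G β cce es hh s a b k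
    have hb := hes (some (⟨h - 1, by omega⟩, (s, a, b), ⟨t - 1, by omega⟩, true))
    simp only [badEvent, Set.mem_ofPred_eq, not_lt, Nat.sub_add_cancel hh,
      Nat.sub_add_cancel ht0] at hb
    simpa only [neg_one_mul] using
      visitSum_deviation_le G β cce hι (hh.trans hH) _ (by norm_num) ht0 hh ht hb

end Final

/-! ### Numerical estimates for the constants -/

theorem width_le_of_le {H n m c ι ε K : ℝ} (hH : 1 ≤ H) (hn : 0 ≤ n) (hnm : n ≤ m) (hm : 1 ≤ m)
    (hc : 0 ≤ c) (hι : 1 / 2 ≤ ι) (hε : 0 < ε) (hεH : ε ≤ H) (hK : 0 < K)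
    (h : (24 * c + 15) ^ 2 * (H ^ 5 * m * ι / ε ^ 2) ≤ K) :
    3 * (H * (n * H + 8 * c * (√(H ^ 3 * ι) * √(n * K)))) + 9 * √(H ^ 3 * ι * K) ≤ K * ε := by
  have hι0 : 0 < ι := by linarith
  set g := 24 * c + 15 with hg
  have hg1 : 15 ≤ g := by linarith
  have hX : g ^ 2 * (H ^ 5 * m * ι) ≤ K * ε ^ 2 := by
    rw [← mul_div_assoc, div_le_iff₀ (by positivity)] at h
    exact h
  set R := √(H ^ 5 * m * ι * K) with hR
  have hRY : g * R ≤ K * ε := by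
    refine le_of_sq_le_sq ?_ (by positivity)
    rw [mul_pow, hR, Real.sq_sqrt (by positivity)]
    -- After squaring, this is the hypothesis on `K` multiplied by `K`.
    nlinarith
  have hS1 : H * (√(H ^ 3 * ι) * √(n * K)) ≤ R := by
    rw [hR]
    refine Real.le_sqrt_of_sq_le ?_
    rw [mul_pow, mul_pow, Real.sq_sqrt (by positivity), Real.sq_sqrt (by positivity)]
    have : H ^ 2 * (H ^ 3 * ι * (n * K)) = H ^ 5 * ι * K * n := by ring
    rw [this, show H ^ 5 * m * ι * K = H ^ 5 * ι * K * m by ring]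
    exact mul_le_mul_of_nonneg_left hnm (by positivity)
  have hS2 : √(H ^ 3 * ι * K) ≤ R := by
    rw [hR]
    refine Real.sqrt_le_sqrt ?_
    rw [show H ^ 5 * m * ι * K = H ^ 3 * ι * K * (H ^ 2 * m) by ring]
    refine le_mul_of_one_le_right (by positivity) ?_
    nlinarith
  -- The initial widths are not of square-root type. They are absorbed using `ι ≥ 1/2` and `ε ≤ H`.
  have hS3 : g ^ 2 * (n * H ^ 2) ≤ 2 * (K * ε) := by
    have h1 : n * H ^ 2 ≤ 2 * (H ^ 4 * m * ι) := by
      have h2 : (1 : ℝ) ≤ H ^ 2 := one_le_pow₀ hH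
      calc n * H ^ 2 ≤ m * H ^ 2 * 1 := by rw [mul_one]; gcongr
        _ ≤ m * H ^ 2 * (H ^ 2 * (2 * ι)) := by
            refine mul_le_mul_of_nonneg_left ?_ (by positivity)
            nlinarith
        _ = _ := by ring
    have h3 : H * (g ^ 2 * (n * H ^ 2)) ≤ H * (2 * (K * ε)) := by
      calc H * (g ^ 2 * (n * H ^ 2)) ≤ H * (g ^ 2 * (2 * (H ^ 4 * m * ι))) := by gcongr
        _ = 2 * (g ^ 2 * (H ^ 5 * m * ι)) := by ring
        _ ≤ 2 * (K * ε ^ 2) := by linarith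
        _ ≤ 2 * (K * (ε * H)) := by
            have : ε ^ 2 ≤ ε * H := by nlinarith
            gcongr
        _ = _ := by ring
    exact le_of_mul_le_mul_left h3 (by linarith)
  have hS4 : g * (n * H ^ 2) ≤ 2 * (K * ε) := by
    refine le_trans ?_ hS3
    exact mul_le_mul_of_nonneg_right (by nlinarith) (by positivity)
  have hfin : g * (3 * (H * (n * H + 8 * c * (√(H ^ 3 * ι) * √(n * K)))) + 9 * √(H ^ 3 * ι * K))
      ≤ g * (K * ε) := by
    have e1 : 24 * c * (g * (H * (√(H ^ 3 * ι) * √(n * K)))) ≤ 24 * c * (K * ε) :=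
      mul_le_mul_of_nonneg_left
        ((mul_le_mul_of_nonneg_left hS1 (by linarith)).trans hRY) (by positivity)
    have e2 : g * √(H ^ 3 * ι * K) ≤ K * ε :=
      (mul_le_mul_of_nonneg_left hS2 (by linarith)).trans hRY
    calc g * (3 * (H * (n * H + 8 * c * (√(H ^ 3 * ι) * √(n * K)))) + 9 * √(H ^ 3 * ι * K))
        = 3 * (g * (n * H ^ 2)) + 24 * c * (g * (H * (√(H ^ 3 * ι) * √(n * K))))
          + 9 * (g * √(H ^ 3 * ι * K)) := by ring
      _ ≤ 3 * (2 * (K * ε)) + 24 * c * (K * ε) + 9 * (K * ε) := by linarith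
      _ = g * (K * ε) := by rw [hg]; ring
  exact le_of_mul_le_mul_left hfin (by linarith)

/-- Each bad event has probability at most `(p/N)⁴`, and there are at most `3N` of them; `p/N ≤ 1/2`
leaves room. This is where `N ≥ 2` is used. -/
theorem card_mul_exp_neg_le {N n p ι : ℝ} (hN : 2 ≤ N) (hn : n ≤ 3 * N) (hp : 0 < p) (hp1 : p ≤ 1)
    (hι : ι = Real.log (N / p)) : 1 / 2 ≤ ι ∧ n * Real.exp (-(4 * ι)) ≤ p := by
  have hN0 : 0 < N := by linarith
  have hexp : Real.exp (-ι) = p / N := by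
    rw [hι, Real.exp_neg, Real.exp_log (by positivity), inv_div]
  have hle : p / N ≤ 1 / 2 := by
    rw [div_le_div_iff₀ hN0 two_pos]; linarith
  constructor
  · have h1 : Real.log 2 ≤ ι := by
      rw [hι]
      refine Real.log_le_log two_pos ?_
      rw [le_div_iff₀ hp]
      nlinarith
    have := Real.log_two_gt_d9
    linarith
  · have h4 : Real.exp (-(4 * ι)) = (p / N) ^ 4 := by
      rw [← hexp, ← Real.exp_nat_mul]; congr 1; push_cast; ring
    have h0 : 0 < p / N := by positivity
    rw [h4]
    calc n * (p / N) ^ 4 ≤ 3 * N * (p / N) ^ 4 := by gcongr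
      _ = 3 * p * (p / N) ^ 3 := by field_simp
      _ ≤ 3 * p * (1 / 2) ^ 3 := by gcongr
      _ ≤ p := by linarith

end

/-! ### The sample complexity bound -/

theorem mainTheorem1 :
    ∃ c₀ : ℝ, 0 < c₀ ∧ ∀ c : ℝ, c₀ ≤ c → ∃ C : ℝ, 0 < C ∧
      ∀ (𝒮 𝒜 ℬ : Type*) [Fintype 𝒮] [Fintype 𝒜] [Nonempty 𝒜] [Fintype ℬ] [Nonempty ℬ]
        (G : MarkovGame 𝒮 𝒜 ℬ) (S A B : ℕ),
        1 ≤ G.H → Fintype.card 𝒮 ≤ S → Fintype.card 𝒜 = A → Fintype.card ℬ = B →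
        ∀ cce : (𝒜 → ℬ → ℝ) → (𝒜 → ℬ → ℝ) → PMF (𝒜 × ℬ), IsCCESubroutine G.H cce →
        ∀ (μ₀ : ℕ → 𝒮 → PMF 𝒜) (ν₀ : ℕ → 𝒮 → PMF ℬ)
          (p ε ι : ℝ) (K : ℕ) (hK : 0 < K), 0 < p → p ≤ 1 → 0 < ε →
          ι = Real.log ((S : ℝ) * A * B * (K * G.H) / p) →
          C * ((G.H : ℝ) ^ 5 * S * A * B * ι / ε ^ 2) ≤ K →
          ENNReal.ofReal (1 - p) ≤
            (nashQLaw G (bonus G.H c ι) cce K).toOuterMeasure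
              {es | IsApproxNash G ε
                (certifiedMax G (bonus G.H c ι) cce K hK μ₀ es)
                (certifiedMin G (bonus G.H c ι) cce K hK ν₀ es)} := by
  -- The `4` is the constant of the deviation bound that the bonus must dominate. In `24c + 15`,
  -- bonuses contribute `3 * 8c`, noise `9` and initial widths `3 * 2`.
  refine ⟨4, by norm_num, fun c hc => ⟨(24 * c + 15) ^ 2, by positivity, ?_⟩⟩
  intro 𝒮 𝒜 ℬ _ _ _ _ _ G S A B hH hS hA hB cce hcce μ₀ ν₀ p ε ι K hK hp hp1 hε hι hCK
  have hS1 : 1 ≤ S := (Fintype.card_pos_iff.2 ⟨G.s₁⟩).trans_le hS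
  have hA1 : 1 ≤ A := hA ▸ Fintype.card_pos
  have hB1 : 1 ≤ B := hB ▸ Fintype.card_pos
  have hm1 : 1 ≤ S * A * B := Nat.one_le_iff_ne_zero.2 (by positivity)
  have hKH1 : 1 ≤ K * G.H := Nat.one_le_iff_ne_zero.2 (by positivity)
  -- If the argument of the logarithm without `p` is `1`, then `ι` may vanish and the union bound
  -- fails. But then each player has one action and there is one step, so all policies are in
  -- equilibrium.
  rcases Nat.lt_or_ge (S * A * B * (K * G.H)) 2 with hN | hN
  · have h1 : S * A * B * (K * G.H) = 1 := by
      have : 1 ≤ S * A * B * (K * G.H) := Nat.one_le_iff_ne_zero.2 (by positivity)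
      omega
    have hSAB := Nat.eq_one_of_mul_eq_one_right h1
    have hKH := Nat.eq_one_of_mul_eq_one_left h1
    have hB' : B = 1 := Nat.eq_one_of_mul_eq_one_left hSAB
    have hA' : A = 1 := Nat.eq_one_of_mul_eq_one_left (Nat.eq_one_of_mul_eq_one_right hSAB)
    have hH' : G.H = 1 := Nat.eq_one_of_mul_eq_one_left hKH
    have : Subsingleton 𝒜 := Fintype.card_le_one_iff_subsingleton.1 (by omega)
    have : Subsingleton ℬ := Fintype.card_le_one_iff_subsingleton.1 (by omega)
    refine le_of_le_of_eq ?_ ((PMF.toOuterMeasure_apply_eq_one_iff _ _).2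
      fun es _ => isApproxNash_of_subsingleton hH' _ _ hε.le).symm
    rw [← ENNReal.ofReal_one]
    exact ENNReal.ofReal_le_ofReal (by linarith)
  · have hN' : (2 : ℝ) ≤ (S : ℝ) * A * B * (K * G.H) := by exact_mod_cast hN
    have hcard : Fintype.card (𝒮 × 𝒜 × ℬ) ≤ S * A * B := by
      rw [Fintype.card_prod, Fintype.card_prod, hA, hB, ← mul_assoc]
      gcongr
    have hcardI : (((Finset.univ : Finset (Option (Fin G.H × (𝒮 × 𝒜 × ℬ) × Fin K × Bool))).card
        : ℕ) : ℝ) ≤ 3 * ((S : ℝ) * A * B * (K * G.H)) := by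
      have hle : Fintype.card (Option (Fin G.H × (𝒮 × 𝒜 × ℬ) × Fin K × Bool))
          ≤ 3 * (S * A * B * (K * G.H)) := by
        rw [Fintype.card_option, Fintype.card_prod, Fintype.card_prod (𝒮 × 𝒜 × ℬ),
          Fintype.card_prod (Fin K), Fintype.card_fin, Fintype.card_fin, Fintype.card_bool]
        have := Nat.mul_le_mul_right (K * G.H) hcard
        have e : G.H * (Fintype.card (𝒮 × 𝒜 × ℬ) * (K * 2))
            = 2 * (Fintype.card (𝒮 × 𝒜 × ℬ) * (K * G.H)) := by ring
        omega
      rw [Finset.card_univ]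
      exact_mod_cast hle
    obtain ⟨hι2, hprob⟩ := card_mul_exp_neg_le hN' hcardI hp hp1 hι
    have hι0 : 0 < ι := by linarith
    have hc0 : 0 ≤ c := by linarith
    have hβ : ∀ t, 0 ≤ bonus G.H c ι t := fun t => mul_nonneg hc0 (Real.sqrt_nonneg _)
    refine ofReal_one_sub_le_toOuterMeasure _ _ Finset.univ (badEvent G (bonus G.H c ι) cce ι K)
      hp.le ?_ (fun i _ => toOuterMeasure_badEvent_le hβ i) hprob
    intro es hsupp hgood
    obtain ⟨hlen, hep⟩ := mem_support_nashQLaw G _ cce K es hsupp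
    have hrec : IsRecord G K es := ⟨hlen, hep⟩
    refine (valuesConcentrate_of_notMem_badEvent hι0 hlen
      fun i => hgood i (Finset.mem_univ i)).isApproxNash hK hcce hc hι0.le μ₀ ν₀ ?_
    -- For `ε ≥ H` the claim is trivial, as every single width is at most `H`.
    rcases le_total ε (G.H : ℝ) with hεH | hεH
    · rw [← hrec.totalWidth_one_eq hH]
      have hg : runSum (gapIncrement G (bonus G.H c ι) cce √(ι / (K * (G.H : ℝ) ^ 3))) es
          ≤ 4 * ι := not_lt.1 (hgood none (Finset.mem_univ _))
      refine (hrec.totalWidth_one_le hc0 hι0 hK hH hg).trans ?_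
      refine width_le_of_le (m := (S : ℝ) * A * B) (by exact_mod_cast hH) (Nat.cast_nonneg _)
        (by exact_mod_cast hcard) (by exact_mod_cast hm1) hc0 hι2 hε hεH (by exact_mod_cast hK) ?_
      simpa only [mul_assoc] using hCK
    · calc _ ≤ ∑ _k ∈ Finset.range K, ε := Finset.sum_le_sum fun k _ => by
            have h1 := ((learnerAt G (bonus G.H c ι) cce es k).Vup_mem_Icc G.H 1 G.s₁).2
            have h2 := ((learnerAt G (bonus G.H c ι) cce es k).Vlow_mem_Icc G.H 1 G.s₁).1
            linarith
        _ = K * ε := by rw [Finset.sum_const, Finset.card_range, nsmul_eq_mul]
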